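/- Let $\mathrm{Diff}^\infty([0,\infty))$ be the group of smooth diffeomorphisms of the half line and let $\varphi$ be an element of it that is tangent to the identity to infinite order at $0$ and satisfies $\varphi(x)>x$ for $x>0$. Let $Z_\varphi$ be its centralizer in $\mathrm{Diff}^\infty([0,\infty))$. Let $p\ge 2$ be an integer and $\mu\in\mathbb C$ with $|\mu|>1$. Put $\lambda=\mu^p$, $\tau=1$, and let $$T(z_1,z_2,x)=(\lambda z_1+\tau z_2^{\,p},\ \mu z_2,\ \varphi(x))\quad\text{on}\quad \tilde R=\mathbb C^2\times[0,\infty)\setminus\{(O,0)\}.$$ Let $R=\tilde R/T^{\mathbb Z}$, with the smooth structure and the leafwise complex foliation induced from the foliation of $\tilde R$ by the levels of $x$ (with their standard complex structures), and let $H=\{x=0\}/T^{\mathbb Z}$ be its boundary. Let $\mathrm{Aut}(R)$ be the group of diffeomorphisms of $R$ that preserve the foliation and are biholomorphic between leaves, and let $\mathrm{Aut}(R,H)$ be the subgroup of those that restrict to the identity on $H$. For $\nu\in\mathbb C$ let $\mathcal Z_{\varphi,\nu}$ be the complex vector space of smooth functions $\beta:(0,\infty)\to\mathbb C$ with $\beta\circ\varphi=\nu\beta$.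 Let $\mathcal S_{\varphi,\mu}(\mathbf c)$ be the set of tuples $(\beta_{1,0},\dots,\beta_{1,p-1},\beta_2)$ of smooth functions $(0,\infty)\to\mathbb C$ with $$\beta_{1,j}\circ\varphi=\mu^{p-j}\beta_{1,j}+c_j\,\beta_2^{\,p-j}\quad(0\le j\le p-1),\qquad \beta_2\circ\varphi=\mu\beta_2,\qquad c_j=\binom pj\mu^{-j},$$ which is a group for the law $$(\beta\cdot\gamma)_{1,j}=\gamma_{1,j}+\sum_{i=j}^{p-1}\binom ij\beta_{1,i}\,\gamma_2^{\,i-j},\qquad(\beta\cdot\gamma)_2=\beta_2+\gamma_2,$$ that is, composition of the maps $g_\beta(z_1,z_2,x)=\bigl(z_1+\sum_{j=0}^{p-1}\beta_{1,j}(x)z_2^{\,j},\ z_2+\beta_2(x),\ x\bigr)$, where all components of $\beta$ are extended by $0$ to $x=0$. Then the following hold. 1. There is a short exact sequence of groups $$1\to\mathcal S_{\varphi,\mu}(\mathbf c)\to\mathrm{Aut}(R,H)\to Z_\varphi\to1 .$$ The first map sends $\beta$ to the automorphism of $R$ induced by $g_\beta$. The second sends $f$ to $\eta$, where $f$ has a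 lift $\tilde f:\tilde R\to\tilde R$, a leafwise holomorphic smooth automorphism of $\tilde R$ that is the identity on $\{x=0\}$, whose last component is $\eta(x)$. 2. There is a short exact sequence of groups $$0\to\mathcal Z_{\varphi,\mu^p}\times\mathcal Z_{\varphi,\mu^{p-1}}\times\cdots\times\mathcal Z_{\varphi,\mu}\to\mathcal S_{\varphi,\mu}(\mathbf c)\to\mathcal Z_{\varphi,\mu}\to0,$$ where the outer terms carry pointwise addition, the first map is $(\beta_{1,j})_j\mapsto((\beta_{1,j})_j,0)$ and the second is $(\beta_{1,0},\dots,\beta_{1,p-1},\beta_2)\mapsto\beta_2$. 3. The vector spaces $\mathcal Z_{\varphi,\mu^k}$, $1\le k\le p$, are infinite dimensional. -/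

import Mathlib

open scoped NNReal ContDiff Topology

noncomputable section

/-! ### Diffeomorphisms of the half line -/

/-- A self-map of `[0,∞)` is smooth (up to the end point `0`). -/
def SmoothHalfLineMap (g : ℝ≥0 → ℝ≥0) : Prop :=
  ContDiffOn ℝ ∞ (fun x : ℝ => (g x.toNNReal : ℝ)) (Set.Ici 0)

theorem SmoothHalfLineMap.comp {f g : ℝ≥0 → ℝ≥0} (hf : SmoothHalfLineMap f)
    (hg : SmoothHalfLineMap g) : SmoothHalfLineMap (f ∘ g) := by
  have h := ContDiffOn.comp (t := Set.Ici (0 : ℝ)) hf hg (fun x _ => NNReal.coe_nonneg _)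
  refine h.congr fun x _ => ?_
  simp

theorem SmoothHalfLineMap.id : SmoothHalfLineMap id :=
  contDiffOn_id.congr fun x hx => by simpa using hx

/-- The group `Diff^∞([0,∞))` of smooth diffeomorphisms of the half line, under composition. -/
def DiffHalfLine : Subgroup (Equiv.Perm ℝ≥0) where
  carrier := {g | SmoothHalfLineMap g ∧ SmoothHalfLineMap g.symm}
  mul_mem' := fun ha hb => ⟨ha.1.comp hb.1, hb.2.comp ha.2⟩
  one_mem' := ⟨SmoothHalfLineMap.id, SmoothHalfLineMap.id⟩
  inv_mem' := fun ha => ⟨ha.2, ha.1⟩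

/-- `g` is tangent to the identity to infinite order at `0`: all (one-sided) derivatives of
`g(x) - x` at `0`, of order `k = 0, 1, 2, …`, vanish. -/
def TangentToIdentity (g : DiffHalfLine) : Prop :=
  ∀ k : ℕ, iteratedDerivWithin k (fun x : ℝ => (g.1 x.toNNReal : ℝ) - x) (Set.Ici 0) 0 = 0

/-! ### The spaces of solutions of the functional equations -/

/-- `C^∞((0,∞); ℂ)`.  A function on `(0,∞)` is represented by its extension by `0` to the point
`0`; nothing is required of its behaviour near `0`. -/
def SmoothPos : Submodule ℂ (ℝ≥0 → ℂ) where
  carrier := {β | β 0 = 0 ∧ ContDiffOn ℝ ∞ (fun x : ℝ => β x.toNNReal) (Set.Ioi 0)}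
  add_mem' := fun ha hb => ⟨by simp [ha.1, hb.1], ha.2.add hb.2⟩
  zero_mem' := ⟨rfl, contDiffOn_const⟩
  smul_mem' := fun c _ ha => ⟨by simp [ha.1], contDiffOn_const.smul ha.2⟩

theorem SmoothPos.mul_mem {a b : ℝ≥0 → ℂ} (ha : a ∈ SmoothPos) (hb : b ∈ SmoothPos) :
    (fun x => a x * b x) ∈ SmoothPos :=
  ⟨by simp [ha.1], ha.2.mul hb.2⟩

theorem SmoothPos.mul_pow_mem {a b : ℝ≥0 → ℂ} (ha : a ∈ SmoothPos) (hb : b ∈ SmoothPos) (n : ℕ) :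
    (fun x => a x * b x ^ n) ∈ SmoothPos :=
  ⟨by simp [ha.1], ha.2.mul (hb.2.pow n)⟩

/-- `𝒵_{φ,ν}`: the complex vector space of the smooth functions `β` on `(0,∞)` with
`β(φ(x)) = ν β(x)`. -/
def SpaceZ (φ : DiffHalfLine) (ν : ℂ) : Submodule ℂ (ℝ≥0 → ℂ) where
  carrier := {β | β ∈ SmoothPos ∧ ∀ x, 0 < x → β (φ.1 x) = ν * β x}
  add_mem' := fun ha hb =>
    ⟨SmoothPos.add_mem ha.1 hb.1, fun x hx => by simp [ha.2 x hx, hb.2 x hx, mul_add]⟩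
  zero_mem' := ⟨SmoothPos.zero_mem, fun x _ => by simp⟩
  smul_mem' := fun c _ ha =>
    ⟨SmoothPos.smul_mem c ha.1, fun x hx => by simp [ha.2 x hx, mul_left_comm]⟩

/-- `𝒮_{φ,μ}(c)`: the set of the smooth solutions `((β_{1,0}, …, β_{1,p-1}), β₂)` on `(0,∞)` of
`β_{1,j}(φ(x)) = μ^{p-j} β_{1,j}(x) + c_j β₂(x)^{p-j}` (`0 ≤ j ≤ p-1`) and
`β₂(φ(x)) = μ β₂(x)`. -/
def SpaceS (φ : DiffHalfLine) (μ : ℂ) (p : ℕ) (c : Fin p → ℂ) :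
    Set ((Fin p → ℝ≥0 → ℂ) × (ℝ≥0 → ℂ)) :=
  {β | (∀ j, β.1 j ∈ SmoothPos) ∧ β.2 ∈ SmoothPos ∧
    (∀ (j : Fin p) (x : ℝ≥0), 0 < x → β.1 j (φ.1 x) =
      μ ^ (p - (j : ℕ)) * β.1 j x + c j * β.2 x ^ (p - (j : ℕ))) ∧
    ∀ x : ℝ≥0, 0 < x → β.2 (φ.1 x) = μ * β.2 x}

/-- The constants `c_j = binom(p,j) μ^{-j}`. -/
def hopfCoeff (p : ℕ) (μ : ℂ) (j : Fin p) : ℂ := (p.choose j : ℂ) * (μ ^ (j : ℕ))⁻¹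

/-! ### The group structure on `𝒮_{φ,μ}(c)` for these constants

It is composition of the maps
`(z₁, z₂, x) ↦ (z₁ + ∑_j β_{1,j}(x) z₂^j, z₂ + β₂(x), x)`, written out on coefficients. -/

/-- The product: `(β · γ)_{1,j} = ∑_i binom(i,j) β_{1,i} γ₂^{i-j} + γ_{1,j}` (only `i ≥ j`
contributes) and `(β · γ)₂ = β₂ + γ₂`. -/
def coeffMul {p : ℕ} (β γ : (Fin p → ℝ≥0 → ℂ) × (ℝ≥0 → ℂ)) :
    (Fin p → ℝ≥0 → ℂ) × (ℝ≥0 → ℂ) :=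
  (fun j x => ∑ i : Fin p, ((i : ℕ).choose j : ℂ) * (β.1 i x * γ.2 x ^ ((i : ℕ) - (j : ℕ)))
      + γ.1 j x,
    fun x => β.2 x + γ.2 x)

/-- The inverse for `coeffMul`. -/
def coeffInv {p : ℕ} (β : (Fin p → ℝ≥0 → ℂ) × (ℝ≥0 → ℂ)) :
    (Fin p → ℝ≥0 → ℂ) × (ℝ≥0 → ℂ) :=
  (fun j x => -∑ i : Fin p, ((i : ℕ).choose j : ℂ) *
      (β.1 i x * (-β.2 x) ^ ((i : ℕ) - (j : ℕ))),
    fun x => -β.2 x)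

/-- The map `(z₁, z₂) ↦ (z₁ + ∑_j β_{1,j}(x) z₂^j, z₂ + β₂(x))` of `ℂ²`, for fixed `x`. -/
def coeffAct {p : ℕ} (β : (Fin p → ℝ≥0 → ℂ) × (ℝ≥0 → ℂ)) (x : ℝ≥0) (z : ℂ × ℂ) : ℂ × ℂ :=
  (z.1 + ∑ j : Fin p, β.1 j x * z.2 ^ (j : ℕ), z.2 + β.2 x)

theorem sum_choose_pow (p i : ℕ) (hi : i < p) (z w : ℂ) :
    (z + w) ^ i = ∑ j : Fin p, ((i.choose j : ℕ) : ℂ) * w ^ (i - (j : ℕ)) * z ^ (j : ℕ) := by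
  rw [add_pow, Fin.sum_univ_eq_sum_range (fun j => ((i.choose j : ℕ) : ℂ) * w ^ (i - j) * z ^ j) p]
  rw [← Finset.sum_subset (Finset.range_subset_range.2 (Nat.succ_le_of_lt hi))]
  · exact Finset.sum_congr rfl fun j _ => by ring
  · intro j _ hj
    rw [Nat.choose_eq_zero_of_lt (by simpa using hj)]
    simp

theorem coeffAct_mul {p : ℕ} (β γ : (Fin p → ℝ≥0 → ℂ) × (ℝ≥0 → ℂ)) (x : ℝ≥0) (z : ℂ × ℂ) :
    coeffAct (coeffMul β γ) x z = coeffAct β x (coeffAct γ x z) := by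
  have key : ∑ i : Fin p, β.1 i x * (z.2 + γ.2 x) ^ (i : ℕ) =
      ∑ j : Fin p, (∑ i : Fin p, ((i : ℕ).choose j : ℂ) *
        (β.1 i x * γ.2 x ^ ((i : ℕ) - (j : ℕ)))) * z.2 ^ (j : ℕ) := by
    simp_rw [Finset.sum_mul]
    rw [Finset.sum_comm]
    refine Finset.sum_congr rfl fun i _ => ?_
    rw [sum_choose_pow p i i.2, Finset.mul_sum]
    exact Finset.sum_congr rfl fun j _ => by ring
  ext
  · simp only [coeffAct, coeffMul, key, add_mul, Finset.sum_add_distrib]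
    ring
  · simp only [coeffAct, coeffMul]
    ring

theorem coeffAct_inv {p : ℕ} (β : (Fin p → ℝ≥0 → ℂ) × (ℝ≥0 → ℂ)) (x : ℝ≥0) (z : ℂ × ℂ) :
    coeffAct (coeffInv β) x (coeffAct β x z) = z := by
  have key : ∀ w : ℂ, ∑ i : Fin p, β.1 i x * (w + -β.2 x) ^ (i : ℕ) =
      ∑ j : Fin p, (∑ i : Fin p, ((i : ℕ).choose j : ℂ) *
        (β.1 i x * (-β.2 x) ^ ((i : ℕ) - (j : ℕ)))) * w ^ (j : ℕ) := by
    intro w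
    simp_rw [Finset.sum_mul]
    rw [Finset.sum_comm]
    refine Finset.sum_congr rfl fun i _ => ?_
    rw [sum_choose_pow p i i.2, Finset.mul_sum]
    exact Finset.sum_congr rfl fun j _ => by ring
  ext
  · simp only [coeffAct, coeffInv, neg_mul, Finset.sum_neg_distrib, ← key]
    simp
  · simp [coeffAct, coeffInv]

theorem coeffAct_injective {p : ℕ} {β γ : (Fin p → ℝ≥0 → ℂ) × (ℝ≥0 → ℂ)}
    (h : ∀ x z, coeffAct β x z = coeffAct γ x z) : β = γ := by
  refine Prod.ext (funext fun j => funext fun x => ?_) (funext fun x => ?_)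
  · have hp : (∑ i : Fin p, Polynomial.monomial (i : ℕ) (β.1 i x)) =
        ∑ i : Fin p, Polynomial.monomial (i : ℕ) (γ.1 i x) := by
      refine Polynomial.funext fun w => ?_
      have := congrArg Prod.fst (h x (0, w))
      simpa [coeffAct, Polynomial.eval_finsetSum] using this
    have := congrArg (fun q => Polynomial.coeff q (j : ℕ)) hp
    simpa [Polynomial.finsetSum_coeff, Polynomial.coeff_monomial, Fin.val_inj] using this
  · have := congrArg Prod.snd (h x (0, 0))
    simpa [coeffAct] using this

theorem coeffMul_assoc {p : ℕ} (α β γ : (Fin p → ℝ≥0 → ℂ) × (ℝ≥0 → ℂ)) :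
    coeffMul (coeffMul α β) γ = coeffMul α (coeffMul β γ) :=
  coeffAct_injective fun x z => by simp only [coeffAct_mul]

theorem coeffMul_zero_left {p : ℕ} (β : (Fin p → ℝ≥0 → ℂ) × (ℝ≥0 → ℂ)) :
    coeffMul 0 β = β := by
  refine coeffAct_injective fun x z => ?_
  rw [coeffAct_mul]
  simp [coeffAct]

theorem coeffMul_inv_left {p : ℕ} (β : (Fin p → ℝ≥0 → ℂ) × (ℝ≥0 → ℂ)) :
    coeffMul (coeffInv β) β = 0 := by
  refine coeffAct_injective fun x z => ?_
  rw [coeffAct_mul, coeffAct_inv]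
  simp [coeffAct]

theorem sum_hopfCoeff (p : ℕ) (μ : ℂ) (hμ : μ ≠ 0) (j : Fin p) (s t : ℂ) :
    ∑ i : Fin p, ((i : ℕ).choose j : ℂ) *
        ((hopfCoeff p μ i * s ^ (p - (i : ℕ))) * (μ * t) ^ ((i : ℕ) - (j : ℕ))) =
      hopfCoeff p μ j * ((s + t) ^ (p - (j : ℕ)) - t ^ (p - (j : ℕ))) := by
  obtain ⟨j, hj⟩ := j
  obtain ⟨m, rfl⟩ := Nat.exists_eq_add_of_lt hj
  simp only [hopfCoeff]
  rw [Fin.sum_univ_eq_sum_range (fun i => (i.choose j : ℂ) *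
    (((j + m + 1).choose i * (μ ^ i)⁻¹ * s ^ (j + m + 1 - i)) * (μ * t) ^ (i - j))) (j + m + 1)]
  rw [add_assoc, Finset.sum_range_add, Finset.sum_eq_zero (s := Finset.range j), zero_add,
    Nat.add_sub_cancel_left]
  · have hb : (s + t) ^ (m + 1) - t ^ (m + 1) = ∑ k ∈ Finset.range (m + 1),
        t ^ k * s ^ (m + 1 - k) * ((m + 1).choose k : ℂ) := by
      rw [add_comm s t, add_pow, Finset.sum_range_succ]
      simp
    rw [hb, Finset.mul_sum]
    refine Finset.sum_congr rfl fun k hk => ?_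
    have hk' : k < m + 1 := Finset.mem_range.1 hk
    have hc : ((j + (m + 1)).choose (j + k) : ℂ) * ((j + k).choose j : ℂ) =
        ((j + (m + 1)).choose j : ℂ) * ((m + 1).choose k : ℂ) := by
      have := Nat.choose_mul (n := j + (m + 1)) (k := j + k) (s := j) (by omega)
      simp only [Nat.add_sub_cancel_left] at this
      exact_mod_cast this
    rw [Nat.add_sub_cancel_left, Nat.add_sub_add_left, mul_pow]
    have hμk : (μ ^ (j + k))⁻¹ * μ ^ k = (μ ^ j)⁻¹ := by
      rw [pow_add, mul_inv, mul_assoc, inv_mul_cancel₀ (pow_ne_zero _ hμ), mul_one]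
    calc _ = (((j + (m + 1)).choose (j + k) : ℂ) * ((j + k).choose j : ℂ)) *
          ((μ ^ (j + k))⁻¹ * μ ^ k) * (t ^ k * s ^ (m + 1 - k)) := by ring
      _ = _ := by rw [hc, hμk]; ring
  · intro i hi
    rw [Nat.choose_eq_zero_of_lt (Finset.mem_range.1 hi)]
    simp

theorem pow_sub_mul_pow_sub (p : ℕ) (μ : ℂ) (i j : Fin p) (a b : ℂ) :
    ((i : ℕ).choose j : ℂ) * ((μ ^ (p - (i : ℕ)) * a) * (μ * b) ^ ((i : ℕ) - (j : ℕ))) =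
      μ ^ (p - (j : ℕ)) * (((i : ℕ).choose j : ℂ) * (a * b ^ ((i : ℕ) - (j : ℕ)))) := by
  rcases lt_or_ge (i : ℕ) (j : ℕ) with h | h
  · rw [Nat.choose_eq_zero_of_lt h]
    simp
  · have hi := i.2
    have : p - (j : ℕ) = (p - (i : ℕ)) + ((i : ℕ) - (j : ℕ)) := by omega
    rw [this, pow_add, mul_pow]
    ring

theorem coeffMul_mem {φ : DiffHalfLine} {μ : ℂ} (hμ : μ ≠ 0) {p : ℕ}
    {β γ : (Fin p → ℝ≥0 → ℂ) × (ℝ≥0 → ℂ)} (hβ : β ∈ SpaceS φ μ p (hopfCoeff p μ))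
    (hγ : γ ∈ SpaceS φ μ p (hopfCoeff p μ)) :
    coeffMul β γ ∈ SpaceS φ μ p (hopfCoeff p μ) := by
  obtain ⟨b1, b2, b3, b4⟩ := hβ
  obtain ⟨g1, g2, g3, g4⟩ := hγ
  refine ⟨fun j => ?_, SmoothPos.add_mem b2 g2, fun j x hx => ?_, fun x hx => ?_⟩
  · refine SmoothPos.add_mem (x := fun x => ∑ i : Fin p, ((i : ℕ).choose j : ℂ) *
      (β.1 i x * γ.2 x ^ ((i : ℕ) - (j : ℕ)))) ?_ (g1 j)
    have := SmoothPos.sum_mem (t := Finset.univ) (f := fun i : Fin p => fun x =>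
      ((i : ℕ).choose j : ℂ) * (β.1 i x * γ.2 x ^ ((i : ℕ) - (j : ℕ))))
      fun i _ => SmoothPos.smul_mem _ (SmoothPos.mul_pow_mem (b1 i) g2 _)
    convert this using 1
    ext x
    simp
  · simp only [coeffMul, b3 _ x hx, g3 _ x hx, g4 x hx, add_mul, mul_add, Finset.sum_add_distrib,
      sum_hopfCoeff p μ hμ, pow_sub_mul_pow_sub, Finset.mul_sum]
    ring
  · simp only [coeffMul, b4 x hx, g4 x hx]
    ring

theorem coeffInv_mem {φ : DiffHalfLine} {μ : ℂ} (hμ : μ ≠ 0) {p : ℕ}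
    {β : (Fin p → ℝ≥0 → ℂ) × (ℝ≥0 → ℂ)} (hβ : β ∈ SpaceS φ μ p (hopfCoeff p μ)) :
    coeffInv β ∈ SpaceS φ μ p (hopfCoeff p μ) := by
  obtain ⟨b1, b2, b3, b4⟩ := hβ
  have b2' : (fun x => -β.2 x) ∈ SmoothPos := SmoothPos.neg_mem b2
  refine ⟨fun j => ?_, b2', fun j x hx => ?_, fun x hx => ?_⟩
  · refine SmoothPos.neg_mem (x := fun x => ∑ i : Fin p, ((i : ℕ).choose j : ℂ) *
      (β.1 i x * (-β.2 x) ^ ((i : ℕ) - (j : ℕ)))) ?_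
    have := SmoothPos.sum_mem (t := Finset.univ) (f := fun i : Fin p => fun x =>
      ((i : ℕ).choose j : ℂ) * (β.1 i x * (-β.2 x) ^ ((i : ℕ) - (j : ℕ))))
      fun i _ => SmoothPos.smul_mem _ (SmoothPos.mul_pow_mem (b1 i) b2' _)
    convert this using 1
    ext x
    simp
  · have h0 : (0 : ℂ) ^ (p - (j : ℕ)) = 0 := zero_pow (by have := j.2; omega)
    simp only [coeffInv, b3 _ x hx, b4 x hx, ← mul_neg, add_mul, mul_add, Finset.sum_add_distrib,
      sum_hopfCoeff p μ hμ, pow_sub_mul_pow_sub, add_neg_cancel, h0]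
    simp only [neg_add, mul_neg, sub_eq_add_neg]
    rw [Finset.mul_sum]
    simp
  · simp only [coeffInv, b4 x hx]
    ring

/-! ### Hopf construction -/

/-- The data `(λ, μ, τ, p, φ)` of a Hopf construction. -/
structure HopfData where
  lam : ℂ
  mu : ℂ
  tau : ℂ
  p : ℕ
  φ : DiffHalfLine
  one_le_p : 1 ≤ p
  one_lt_norm_mu : 1 < ‖mu‖
  norm_mu_le : ‖mu‖ ≤ ‖lam‖
  resonance : (lam - mu ^ p) * tau = 0
  expanding : ∀ x : ℝ≥0, 0 < x → x < φ.1 x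

/-- `R̃ = ℂ² × [0,∞) \ {(O,0)}`. -/
abbrev ReebCover : Type := {q : (ℂ × ℂ) × ℝ≥0 // q ≠ 0}

/-- The inclusion of `R̃` in the real vector space `ℂ² × ℝ`. -/
def ReebCover.toAmbient (q : ReebCover) : (ℂ × ℂ) × ℝ := (q.1.1, (q.1.2 : ℝ))

/-- A self-map `F` of `R̃` is, at the point `q`, smooth (up to the boundary) and a leafwise
holomorphic map of the foliation by the levels of the last coordinate `x`. `G` is `F` near `q`,
written in the coordinates of `ℂ² × ℝ`; along the leaf through `q`, its `ℂ²`-component is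
holomorphic at `q`, and its transverse component is locally constant (the foliation is
preserved). -/
def LeafwiseHolSmoothAt (F : ReebCover → ReebCover) (q : ReebCover) : Prop :=
  ∃ G : (ℂ × ℂ) × ℝ → (ℂ × ℂ) × ℝ,
    (∀ᶠ r in 𝓝 q, (F r).toAmbient = G r.toAmbient) ∧
    ContDiffWithinAt ℝ ∞ G (Set.range ReebCover.toAmbient) q.toAmbient ∧
    DifferentiableAt ℂ (fun z : ℂ × ℂ => (G (z, (q.1.2 : ℝ))).1) q.1.1 ∧
    ∀ᶠ z in 𝓝 q.1.1, (G (z, (q.1.2 : ℝ))).2 = (G q.toAmbient).2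

theorem ReebCover.isEmbedding_toAmbient : Topology.IsEmbedding ReebCover.toAmbient :=
  (Topology.IsEmbedding.id.prodMap NNReal.isEmbedding_coe).comp Topology.IsEmbedding.subtypeVal

theorem LeafwiseHolSmoothAt.continuousAt {F : ReebCover → ReebCover} {q : ReebCover}
    (h : LeafwiseHolSmoothAt F q) : ContinuousAt F q := by
  obtain ⟨G, h1, h2, -, -⟩ := h
  rw [ReebCover.isEmbedding_toAmbient.continuousAt_iff]
  have h3 : ContinuousAt (G ∘ ReebCover.toAmbient) q := by
    have := h2.continuousWithinAt
    rw [ContinuousWithinAt, ← ReebCover.isEmbedding_toAmbient.map_nhds_eq] at this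
    exact this
  exact h3.congr (h1.mono fun r hr => hr.symm)

theorem LeafwiseHolSmoothAt.id (q : ReebCover) : LeafwiseHolSmoothAt id q :=
  ⟨fun v => v, Filter.Eventually.of_forall fun _ => rfl, contDiffWithinAt_id,
    differentiableAt_id, Filter.Eventually.of_forall fun _ => rfl⟩

theorem LeafwiseHolSmoothAt.comp {F F' : ReebCover → ReebCover} {q : ReebCover}
    (h' : LeafwiseHolSmoothAt F' (F q)) (h : LeafwiseHolSmoothAt F q) :
    LeafwiseHolSmoothAt (F' ∘ F) q := by
  have hc := h.continuousAt
  obtain ⟨G, h1, h2, h3, h4⟩ := h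
  obtain ⟨G', k1, k2, k3, k4⟩ := h'
  have hq : (F q).toAmbient = G q.toAmbient := h1.self_of_nhds
  have hq1 : (G (q.1.1, (q.1.2 : ℝ))).1 = (F q).1.1 := (congrArg Prod.fst hq).symm
  have hq2 : (G q.toAmbient).2 = ((F q).1.2 : ℝ) := (congrArg Prod.snd hq).symm
  have hz : ∀ᶠ z in 𝓝 q.1.1,
      G (z, (q.1.2 : ℝ)) = ((G (z, (q.1.2 : ℝ))).1, ((F q).1.2 : ℝ)) :=
    h4.mono fun z hz => Prod.ext rfl (hz.trans hq2)
  refine ⟨G' ∘ G, ?_, ?_, ?_, ?_⟩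
  · filter_upwards [h1, hc.eventually k1] with r hr hr'
    simp only [Function.comp_apply, hr', ← hr]
  · rw [hq] at k2
    refine k2.comp_of_preimage_mem_nhdsWithin _ h2 ?_
    rw [← ReebCover.isEmbedding_toAmbient.map_nhds_eq]
    exact h1.mono fun r hr => ⟨F r, hr⟩
  · have := DifferentiableAt.comp (x := q.1.1) (g := fun z : ℂ × ℂ => (G' (z, ((F q).1.2 : ℝ))).1)
      (f := fun z : ℂ × ℂ => (G (z, (q.1.2 : ℝ))).1) (by rw [hq1]; exact k3) h3
    refine this.congr_of_eventuallyEq (hz.mono fun z hz => ?_)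
    simp only [Function.comp_apply]
    rw [hz]
  · have hct : Filter.Tendsto (fun z : ℂ × ℂ => (G (z, (q.1.2 : ℝ))).1) (𝓝 q.1.1)
        (𝓝 (F q).1.1) := by
      have := h3.continuousAt
      rwa [ContinuousAt, hq1] at this
    filter_upwards [hz, hct.eventually k4] with z hz hz'
    simp only [Function.comp_apply]
    rw [hz, hz', hq]

namespace HopfData

variable (D : HopfData)

theorem mu_ne_zero : D.mu ≠ 0 :=
  norm_pos_iff.1 (one_pos.trans D.one_lt_norm_mu)

theorem lam_ne_zero : D.lam ≠ 0 :=
  norm_pos_iff.1 ((one_pos.trans D.one_lt_norm_mu).trans_le D.norm_mu_le)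

theorem φ_zero : D.φ.1 0 = 0 := by
  obtain ⟨y, hy⟩ := D.φ.1.surjective 0
  rcases eq_or_ne y 0 with rfl | h
  · exact hy
  · have h1 := D.expanding y (pos_iff_ne_zero.2 h)
    rw [show D.φ.1 y = 0 from hy] at h1
    exact absurd h1 (not_lt.2 zero_le)

/-- `(z₁, z₂, x) ↦ (λ z₁ + τ z₂^p, μ z₂, φ(x))` on `ℂ² × [0,∞)`. -/
def ambientT : Equiv.Perm ((ℂ × ℂ) × ℝ≥0) where
  toFun q := ((D.lam * q.1.1 + D.tau * q.1.2 ^ D.p, D.mu * q.1.2), D.φ.1 q.2)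
  invFun q := (((q.1.1 - D.tau * (q.1.2 / D.mu) ^ D.p) / D.lam, q.1.2 / D.mu),
    D.φ.1.symm q.2)
  left_inv := by
    rintro ⟨⟨a, b⟩, x⟩
    have h1 := D.mu_ne_zero
    have h2 := D.lam_ne_zero
    simp [h1, h2]
  right_inv := by
    rintro ⟨⟨a, b⟩, x⟩
    have h1 := D.mu_ne_zero
    have h2 := D.lam_ne_zero
    simp [h1, h2, mul_div_cancel₀]

theorem ambientT_zero : D.ambientT 0 = 0 := by
  have hp : D.p ≠ 0 := Nat.one_le_iff_ne_zero.1 D.one_le_p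
  have h0 := D.φ_zero
  simp [ambientT, hp, h0]

/-- The transformation `T = G × φ` of `R̃`. -/
def T : Equiv.Perm ReebCover :=
  D.ambientT.subtypeEquiv fun q => by
    rw [not_iff_not]
    constructor
    · rintro rfl
      exact D.ambientT_zero
    · intro h
      exact D.ambientT.injective (h.trans D.ambientT_zero.symm)

/-- The Reeb component `R = R̃ / T^ℤ`, with the quotient topology. Its smooth structure and its
foliation with leafwise complex structure are those for which the covering `R̃ → R` is a local
isomorphism. -/
def Reeb : Type := MulAction.orbitRel.Quotient (Subgroup.zpowers D.T) ReebCover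

instance : TopologicalSpace D.Reeb :=
  inferInstanceAs (TopologicalSpace (MulAction.orbitRel.Quotient (Subgroup.zpowers D.T) ReebCover))

/-- The covering projection `R̃ → R`. -/
def proj (q : ReebCover) : D.Reeb :=
  Quotient.mk (MulAction.orbitRel (Subgroup.zpowers D.T) ReebCover) q

/-- The boundary `H = W / G^ℤ` of `R`, the image of `{x = 0}`. -/
def boundary : Set D.Reeb := D.proj '' {q | q.1.2 = 0}

/-- A self-map of `R` is smooth and leafwise holomorphic: near every point it is induced by a
self-map of `R̃` which is smooth and leafwise holomorphic there. -/
def IsLeafwiseHolSmooth (f : D.Reeb → D.Reeb) : Prop :=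
  ∀ q : ReebCover, ∃ F : ReebCover → ReebCover, LeafwiseHolSmoothAt F q ∧
    ∀ᶠ r in 𝓝 q, f (D.proj r) = D.proj (F r)

variable {D}

theorem IsLeafwiseHolSmooth.id : D.IsLeafwiseHolSmooth id := fun q =>
  ⟨_, LeafwiseHolSmoothAt.id q, Filter.Eventually.of_forall fun _ => rfl⟩

theorem IsLeafwiseHolSmooth.comp {g f : D.Reeb → D.Reeb} (hg : D.IsLeafwiseHolSmooth g)
    (hf : D.IsLeafwiseHolSmooth f) : D.IsLeafwiseHolSmooth (g ∘ f) := fun q => by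
  obtain ⟨F, h1, h2⟩ := hf q
  obtain ⟨F', k1, k2⟩ := hg (F q)
  refine ⟨F' ∘ F, k1.comp h1, ?_⟩
  filter_upwards [h2, h1.continuousAt.eventually k2] with r hr hr'
  simp only [Function.comp_apply, hr, hr']

variable (D)

/-- `Aut R`: the group of leafwise holomorphic smooth automorphisms of `R`. -/
def Aut : Subgroup (D.Reeb ≃ₜ D.Reeb) where
  carrier := {f | D.IsLeafwiseHolSmooth f ∧ D.IsLeafwiseHolSmooth f.symm}
  mul_mem' := fun ha hb => ⟨ha.1.comp hb.1, hb.2.comp ha.2⟩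
  one_mem' := ⟨IsLeafwiseHolSmooth.id, IsLeafwiseHolSmooth.id⟩
  inv_mem' := fun ha => ⟨ha.2, ha.1⟩

/-- `Aut(R,H)`: the kernel of the restriction of automorphisms of `R` to the boundary `H`, i.e.
the automorphisms of `R` which are the identity on `H`. -/
def AutRel : Subgroup D.Aut where
  carrier := {f | ∀ q ∈ D.boundary, (f : D.Reeb ≃ₜ D.Reeb) q = q}
  mul_mem' := fun {a b} ha hb q hq => by
    change (a : D.Reeb ≃ₜ D.Reeb) ((b : D.Reeb ≃ₜ D.Reeb) q) = q
    rw [hb q hq, ha q hq]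
  one_mem' := fun _ _ => rfl
  inv_mem' := fun {a} ha q hq => by
    change (a : D.Reeb ≃ₜ D.Reeb).symm q = q
    exact (Homeomorph.symm_apply_eq _).2 (ha q hq).symm

/-- `Z_φ`: the centralizer of `φ` in `Diff^∞([0,∞))`. -/
abbrev Centralizer : Subgroup DiffHalfLine := Subgroup.centralizer {D.φ}

/-- `𝒮_{φ,μ}(c)` with `c_j = binom(p,j) μ^{-j}`. -/
def S : Type := SpaceS D.φ D.mu D.p (hopfCoeff D.p D.mu)

/-- The component `β_{1,j}` of a solution. -/
def S.beta1 {D : HopfData} (β : D.S) (j : Fin D.p) : ℝ≥0 → ℂ := β.1.1 j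

/-- The component `β₂` of a solution. -/
def S.beta2 {D : HopfData} (β : D.S) : ℝ≥0 → ℂ := β.1.2

instance : Mul D.S := ⟨fun β γ => ⟨coeffMul β.1 γ.1, coeffMul_mem D.mu_ne_zero β.2 γ.2⟩⟩

instance : Inv D.S := ⟨fun β => ⟨coeffInv β.1, coeffInv_mem D.mu_ne_zero β.2⟩⟩

instance : One D.S := ⟨⟨0, fun _ => SmoothPos.zero_mem, SmoothPos.zero_mem, fun j x _ => by
  have h0 : (0 : ℂ) ^ (D.p - (j : ℕ)) = 0 := zero_pow (by have := j.2; omega)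
  simp [h0], fun x _ => by simp⟩⟩

instance : Group D.S :=
  Group.ofLeftAxioms (fun a b c => Subtype.ext (coeffMul_assoc a.1 b.1 c.1))
    (fun a => Subtype.ext (coeffMul_zero_left a.1))
    (fun a => Subtype.ext (coeffMul_inv_left a.1))

/-- The transformation
`(z₁, z₂, x) ↦ (z₁ + ∑_{j<p} β_{1,j}(x) z₂^j, z₂ + β₂(x), x)` of `R̃` given by a solution (extended
by `0` to `x = 0`). -/
def S.shear {D : HopfData} (β : D.S) (q : ReebCover) : ReebCover :=
  ⟨((q.1.1.1 + ∑ j : Fin D.p, β.beta1 j q.1.2 * q.1.1.2 ^ (j : ℕ), q.1.1.2 + β.beta2 q.1.2),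
      q.1.2), by
    obtain ⟨⟨⟨a, b⟩, x⟩, hq⟩ := q
    intro h
    have hx : x = 0 := congrArg Prod.snd h
    subst hx
    have h1 : ∀ j, β.beta1 j 0 = 0 := fun j => (β.2.1 j).1
    have h2 : β.beta2 0 = 0 := β.2.2.1.1
    simp only [h1, h2, zero_mul, Finset.sum_const_zero, add_zero] at h
    exact hq h⟩

end HopfData

end

noncomputable section

open Set Filter

/-! ### Orbits of expanding maps -/

/-! The whole problem is moved to the covering `R̃`. This space is contractible, since it is
star-shaped about `(O,1)`, and `T` acts on it as the generator of a covering group: points with `x >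
0` are moved off themselves by `φ`, boundary points by the expansion `G(z₁,z₂) = (λz₁ + τz₂^p,
μz₂)`. An element of `Aut(R,H)` therefore has a lift fixing one boundary point. As `{x = 0} = ℂ² ∖
{O}` is connected, this lift is the identity on the whole boundary, and uniqueness of lifts makes it
commute with `T`. So `Aut(R,H)` is the group of leafwise holomorphic automorphisms of `R̃` that
commute with `T` and fix the boundary pointwise (`descend_bijective`).

The last component of such a lift is constant on leaves and commutes with `φ`; every `η` in `Z_φ`
occurs, through `id × η`. A lift in the kernel is a family of entire maps `Φ_x` of `ℂ²`, `x > 0`,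
with `Φ_{φ(x)} ∘ G = G ∘ Φ_x`. As `x → 0` it tends to the identity uniformly on the unit sphere,
hence on the unit ball by the maximum principle, although the lift is not defined at `(O,0)`
(`eventually_norm_fiberMap_sub_le`). The orbits of `T⁻¹` converge to `(O,0)`, so a quantity that
does not increase along `T` and is small near there is nonpositive (`nonpos_of_le_along_T`). Applied
to norms of derivatives, with Cauchy estimates, this kills all dependence of `Φ_x - id` on `z₁` and
all but finitely many powers of `z₂`. What remains is a shear, and comparing coefficients gives the
equations of `𝒮`.

Conversely, a solution in `𝒮` has to give a map smooth up to `x = 0`. Solved for the value at `x`,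
its equations are contracting, and they remain so after differentiation because `φ'(0) = 1`. Hence
all derivatives tend to `0` at `0` (`contDiff_of_contracting`).

The other two statements rest on a smooth `t` with `t ∘ φ = t + 1`. Multiplying powers of `β₂` by
`t` solves the resonant equations for `β_{1,j}`, and `exp(t log ν) P(exp(2πit))`, with `P` a
polynomial, gives an infinite dimensional space of solutions of `β ∘ φ = νβ`. -/

/-- A bounded increasing orbit would converge to a fixed point of `f` above `x`. -/
theorem exists_lt_iterate {α : Type*} [ConditionallyCompleteLinearOrder α] [TopologicalSpace α]
    [OrderTopology α] {f : α → α} (hf : Continuous f) {x : α} (hx : ∀ y, x ≤ y → y < f y) (M : α) :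
    ∃ n, M < f^[n] x := by
  by_contra! h
  have hge : ∀ n, x ≤ f^[n] x := fun n => by
    induction n with
    | zero => exact le_rfl
    | succ n ih =>
      rw [Function.iterate_succ_apply']
      exact ih.trans (hx _ ih).le
  have hmono : Monotone fun n => f^[n] x := monotone_nat_of_le_succ fun n => by
    rw [Function.iterate_succ_apply']
    exact (hx _ (hge n)).le
  have hlim := tendsto_atTop_ciSup hmono ⟨M, by rintro _ ⟨n, rfl⟩; exact h n⟩
  have hfix : Function.IsFixedPt f _ := isFixedPt_of_tendsto_iterate hlim hf.continuousAt
  exact (hx _ (ge_of_tendsto' hlim hge)).ne' hfix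

/-! ### Flat functions -/

section Flat

variable {F : Type*} [NormedAddCommGroup F] [NormedSpace ℝ F]

/-- The derivative on `[0,∞)`, continued by `0`, is again a flat function, and it is the derivative
of `f` on both sides of `0`; hence induction on the order. -/
theorem contDiff_of_flat {f : ℝ → F} (h0 : ∀ x ≤ 0, f x = 0) (hf : ContDiffOn ℝ ∞ f (Ici 0))
    (hflat : ∀ k, iteratedDerivWithin k f (Ici 0) 0 = 0) : ContDiff ℝ ∞ f := by
  have hcont : ∀ f : ℝ → F, (∀ x ≤ 0, f x = 0) → ContDiffOn ℝ ∞ f (Ici 0) → Continuous f := by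
    intro f h0 hf
    rw [← continuousOn_univ, ← Iic_union_Ici (a := (0 : ℝ))]
    exact ContinuousOn.union_of_isClosed (continuousOn_const.congr h0) hf.continuousOn
      isClosed_Iic isClosed_Ici
  rw [contDiff_infty]
  intro n
  induction n generalizing f with
  | zero => exact contDiff_zero.2 (hcont f h0 hf)
  | succ n ih =>
    set g : ℝ → F := fun x => if 0 ≤ x then derivWithin f (Ici 0) x else 0 with hg
    have hgeq : EqOn g (derivWithin f (Ici 0)) (Ici 0) := fun x hx => if_pos hx
    have hg0 : ∀ x ≤ 0, g x = 0 := by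
      intro x hx
      rcases hx.lt_or_eq with h | rfl
      · exact if_neg h.not_ge
      · rw [hgeq self_mem_Ici, ← iteratedDerivWithin_one]
        exact hflat 1
    have hgs : ContDiffOn ℝ ∞ g (Ici 0) :=
      ((contDiffOn_infty_iff_derivWithin (uniqueDiffOn_Ici 0)).1 hf).2.congr hgeq
    have hdiff : ∀ x, HasDerivAt f (g x) x := by
      intro x
      have hr : ∀ x, 0 ≤ x → HasDerivWithinAt f (g x) (Ici 0) x := fun x hx => by
        rw [hgeq hx]
        exact (hf.differentiableOn (by simp) x hx).hasDerivWithinAt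
      have hl : ∀ x ≤ 0, HasDerivWithinAt f (g x) (Iic 0) x := fun x hx => by
        rw [hg0 x hx]
        exact (hasDerivWithinAt_const x _ (0 : F)).congr h0 (h0 x hx)
      rcases lt_trichotomy x 0 with h | rfl | h
      · exact (hl x h.le).hasDerivAt (Iic_mem_nhds h)
      · rw [← hasDerivWithinAt_univ, ← Iic_union_Ici (a := (0 : ℝ))]
        exact (hl 0 le_rfl).union (hr 0 le_rfl)
      · exact (hr x h.le).hasDerivAt (Ici_mem_nhds h)
    have hd : deriv f = g := funext fun x => (hdiff x).deriv
    push_cast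
    rw [contDiff_succ_iff_deriv]
    refine ⟨fun x => (hdiff x).differentiableAt, by simp, ?_⟩
    rw [hd]
    refine ih hg0 hgs fun k => ?_
    rw [iteratedDerivWithin_congr hgeq self_mem_Ici, ← iteratedDerivWithin_succ']
    exact hflat _

theorem deriv_eq_zero_of_eqOn_Iic {w : ℝ → F} (hw : Differentiable ℝ w) (h0 : ∀ x ≤ 0, w x = 0)
    {x : ℝ} (hx : x ≤ 0) : deriv w x = 0 := by
  have h1 : HasDerivWithinAt w (deriv w x) (Iic x) x := (hw x).hasDerivAt.hasDerivWithinAt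
  have h2 : HasDerivWithinAt w 0 (Iic x) x :=
    (hasDerivWithinAt_const x _ (0 : F)).congr (fun y hy => h0 y (le_trans hy hx)) (h0 x hx)
  exact (uniqueDiffWithinAt_Iic x).eq_deriv _ h1 h2

end Flat

/-! ### Solutions of contracting functional equations are smooth at the fixed point -/

section FunctionalEquation

variable {φ : ℝ → ℝ}

/-- Near `0` one has `‖u x‖ ≤ θ‖u (φ x)‖ + ε` with `θ < 1`. With `ε = 1` this gives boundedness,
because large values would persist along an orbit until it leaves the neighbourhood. Iterating the
inequality then makes the bound arbitrarily small. -/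
theorem tendsto_zero_of_contracting (hφ : Continuous φ) (hneg : ∀ x ≤ 0, φ x = x)
    (hpos : ∀ x, 0 < x → x < φ x) {a u w : ℝ → ℂ} (ha : ContinuousAt a 0) (ha0 : ‖a 0‖ < 1)
    (hw : Tendsto w (𝓝[>] 0) (𝓝 0)) (hu : ContinuousOn u (Ioi 0))
    (heq : ∀ x, 0 < x → u x = a x * u (φ x) + w x) : Tendsto u (𝓝[>] 0) (𝓝 0) := by
  obtain ⟨θ, hθ1, hθ2⟩ := exists_between ha0
  have hθ0 : 0 ≤ θ := (norm_nonneg _).trans hθ1.le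
  have haθ : ∀ᶠ x in 𝓝[>] 0, ‖a x‖ ≤ θ :=
    (ha.norm.eventually (gt_mem_nhds hθ1)).filter_mono nhdsWithin_le_nhds |>.mono fun _ => le_of_lt
  have hstep : ∀ ε > 0, ∀ᶠ x in 𝓝[>] (0 : ℝ), ‖u x‖ ≤ θ * ‖u (φ x)‖ + ε := by
    intro ε hε
    have hwε : ∀ᶠ x in 𝓝[>] 0, ‖w x‖ < ε := by
      have := hw.norm
      rw [norm_zero] at this
      exact this.eventually (gt_mem_nhds hε)
    filter_upwards [haθ, hwε, self_mem_nhdsWithin] with x h1 h2 h3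
    rw [heq x h3]
    refine (norm_add_le _ _).trans ?_
    rw [norm_mul]
    gcongr
  have hφt : Tendsto φ (𝓝[>] 0) (𝓝[>] 0) := by
    refine tendsto_nhdsWithin_iff.2 ⟨?_, ?_⟩
    · have := hφ.tendsto 0
      rw [hneg 0 le_rfl] at this
      exact this.mono_left nhdsWithin_le_nhds
    · filter_upwards [self_mem_nhdsWithin] with x hx
      exact lt_trans hx (hpos x hx)
  have hbdd : ∃ K, ∀ᶠ x in 𝓝[>] (0 : ℝ), ‖u x‖ ≤ K := by
    obtain ⟨δ, hδ, hδ'⟩ := mem_nhdsGT_iff_exists_Ioc_subset.1 (hstep 1 one_pos)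
    have hδ0 : 0 < δ := hδ
    obtain ⟨M, hM⟩ := (isCompact_Icc (a := (0 : ℝ)) (b := δ)).bddAbove_image hφ.continuousOn
    have hM' : ∀ x, 0 < x → x ≤ δ → φ x ≤ M := fun x h1 h2 => hM ⟨x, ⟨h1.le, h2⟩, rfl⟩
    obtain ⟨C, hC⟩ := (isCompact_Icc (a := δ) (b := M)).exists_bound_of_continuousOn
      (hu.mono fun x hx => hδ0.trans_le hx.1)
    -- `1 / (1 - θ)` ensures `θK + 1 ≤ K`; `C` bounds `u` on `[δ, M]`, where an orbit lands when it
    -- first leaves `(0, δ]`.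
    set K := max C (1 / (1 - θ)) with hK
    have hK1 : θ * K + 1 ≤ K := by
      have h1 : 1 / (1 - θ) ≤ K := le_max_right _ _
      rw [div_le_iff₀ (by linarith)] at h1
      linarith
    refine ⟨K, ?_⟩
    filter_upwards [Ioc_mem_nhdsGT hδ0] with x hx
    -- A value above `K` at a point of `(0, δ]` forces one at its image, which then cannot lie in
    -- `[δ, M]`. The orbit would stay in `(0, δ]` forever.
    by_contra! hlt
    have hall : ∀ n, φ^[n] x ∈ Ioc 0 δ ∧ K < ‖u (φ^[n] x)‖ := by
      intro n
      induction n with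
      | zero => exact ⟨hx, hlt⟩
      | succ n ih =>
        rw [Function.iterate_succ_apply']
        set y := φ^[n] x
        obtain ⟨⟨hy1, hy2⟩, hy3⟩ := ih
        have h1 : ‖u y‖ ≤ θ * ‖u (φ y)‖ + 1 := hδ' ⟨hy1, hy2⟩
        have h2 : K < ‖u (φ y)‖ := by
          by_contra! h
          have := mul_le_mul_of_nonneg_left h hθ0
          linarith
        refine ⟨⟨hy1.trans (hpos y hy1), ?_⟩, h2⟩
        by_contra! h
        exact (hC _ ⟨h.le, hM' y hy1 hy2⟩).not_gt ((le_max_left _ _).trans_lt h2)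
    obtain ⟨n, hn⟩ := exists_lt_iterate hφ (x := x) (fun y hy => hpos y (hx.1.trans_le hy)) δ
    exact (hall n).1.2.not_gt hn
  obtain ⟨K, hK⟩ := hbdd
  rw [Metric.tendsto_nhds]
  intro ε hε
  have hε' : 0 < ε / 2 * (1 - θ) := by
    have : 0 < 1 - θ := by linarith
    positivity
  have hiter : ∀ n : ℕ, ∀ᶠ x in 𝓝[>] (0 : ℝ), ‖u x‖ ≤ θ ^ n * K + ε / 2 * (1 - θ ^ n) := by
    intro n
    induction n with
    | zero => simpa using hK
    | succ n ih =>
      filter_upwards [hstep _ hε', hφt.eventually ih] with x h1 h2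
      have := mul_le_mul_of_nonneg_left h2 hθ0
      calc ‖u x‖ ≤ _ := h1
        _ ≤ _ := add_le_add_left this _
        _ = _ := by ring
  obtain ⟨n, hn⟩ : ∃ n : ℕ, θ ^ n * K < ε / 2 := by
    have := (tendsto_pow_atTop_nhds_zero_of_lt_one hθ0 hθ2).mul_const K
    rw [zero_mul] at this
    exact (this.eventually (gt_mem_nhds (by positivity))).exists
  filter_upwards [hiter n] with x hx
  rw [dist_zero_right]
  have : 0 ≤ ε / 2 * θ ^ n := by positivity
  linarith

/-- Differentiating the equation gives one of the same type for `u'`, with factor `a φ'` and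
inhomogeneous term `a' (u ∘ φ) + w'`, which is `C^n` by induction. Since `φ'(0) = 1`, the factor has
the same value at `0`. A variable `a` is needed for this induction. -/
theorem contDiff_of_contracting (hφ : ContDiff ℝ ∞ φ) (hneg : ∀ x ≤ 0, φ x = x)
    (hpos : ∀ x, 0 < x → x < φ x) (n : ℕ) {a u w : ℝ → ℂ} (ha : ContDiff ℝ ∞ a) (ha0 : ‖a 0‖ < 1)
    (hw : ContDiff ℝ n w) (hw0 : ∀ x ≤ 0, w x = 0) (hu0 : ∀ x ≤ 0, u x = 0)
    (hu : ContDiffOn ℝ ∞ u (Ioi 0)) (heq : ∀ x, 0 < x → u x = a x * u (φ x) + w x) :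
    ContDiff ℝ n u := by
  have hφd : Differentiable ℝ φ := hφ.differentiable (by simp)
  have hφ1 : deriv φ 0 = 1 := by
    have := deriv_eq_zero_of_eqOn_Iic (w := fun x => φ x - x) (hφd.sub differentiable_id)
      (fun x hx => sub_eq_zero.2 (hneg x hx)) le_rfl
    rw [deriv_fun_sub (hφd 0) differentiableAt_fun_id, deriv_id''] at this
    linarith
  have hcont : ∀ {u : ℝ → ℂ}, (∀ x ≤ 0, u x = 0) → ContDiffOn ℝ ∞ u (Ioi 0) →
      Tendsto u (𝓝[>] 0) (𝓝 0) → Continuous u := by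
    intro u hu0 hu ht
    rw [continuous_iff_continuousAt]
    intro x
    rcases lt_trichotomy x 0 with h | rfl | h
    · refine (continuousAt_const (y := (0 : ℂ))).congr ?_
      filter_upwards [Iic_mem_nhds h] with y hy using (hu0 y hy).symm
    · refine continuousAt_iff_continuous_left'_right'.2 ⟨?_, ?_⟩
      · exact (continuousWithinAt_const (b := (0 : ℂ))).congr (fun y hy => hu0 y (le_of_lt hy))
          (hu0 0 le_rfl)
      · rwa [ContinuousWithinAt, hu0 0 le_rfl]
    · exact hu.continuousOn.continuousAt (Ioi_mem_nhds h)
  have htend : ∀ {w : ℝ → ℂ}, Continuous w → (∀ x ≤ 0, w x = 0) → Tendsto w (𝓝[>] 0) (𝓝 0) := by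
    intro w hw hw0
    have := hw.tendsto 0
    rw [hw0 0 le_rfl] at this
    exact this.mono_left nhdsWithin_le_nhds
  induction n generalizing a u w with
  | zero =>
    exact contDiff_zero.2 (hcont hu0 hu (tendsto_zero_of_contracting hφ.continuous hneg hpos
      ha.continuous.continuousAt ha0 (htend hw.continuous hw0) hu.continuousOn heq))
  | succ n ih =>
    have hun : ContDiff ℝ n u := ih ha ha0 (hw.of_le (by exact_mod_cast n.le_succ)) hw0 hu0 hu heq
    push_cast at hw ⊢
    obtain ⟨hwd, -, hw'⟩ := contDiff_succ_iff_deriv.1 hw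
    have hud : ∀ x, 0 < x → DifferentiableAt ℝ u x := fun x hx =>
      (hu.differentiableOn (by simp) x hx).differentiableAt (Ioi_mem_nhds hx)
    have had : Differentiable ℝ a := ha.differentiable (by simp)
    set v : ℝ → ℂ := fun x => if 0 < x then deriv u x else 0 with hv
    have hv0 : ∀ x ≤ 0, v x = 0 := fun x hx => if_neg hx.not_gt
    have hv1 : ∀ x, 0 < x → v x = deriv u x := fun x hx => if_pos hx
    have hvs : ContDiffOn ℝ ∞ v (Ioi 0) :=
      ((contDiffOn_infty_iff_deriv_of_isOpen isOpen_Ioi).1 hu).2.congr hv1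
    have hveq : ∀ x, 0 < x → v x = (a x * (deriv φ x : ℝ)) * v (φ x) +
        (deriv a x * u (φ x) + deriv w x) := by
      intro x hx
      have hφx := hx.trans (hpos x hx)
      have h1 : HasDerivAt (fun y => u (φ y)) ((deriv φ x : ℝ) • deriv u (φ x)) x :=
        HasDerivAt.scomp x (hud _ hφx).hasDerivAt (hφd x).hasDerivAt
      have h2 := ((had x).hasDerivAt.mul h1).add (hwd x).hasDerivAt
      have h3 : u =ᶠ[𝓝 x] (a * fun y => u (φ y)) + w := by
        filter_upwards [Ioi_mem_nhds hx] with y hy using heq y hy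
      rw [hv1 x hx, hv1 _ hφx, (h2.congr_of_eventuallyEq h3).deriv, Complex.real_smul]
      ring
    have hvn : ContDiff ℝ n v := by
      refine ih (a := fun x => a x * (deriv φ x : ℝ)) ?_ ?_ ?_ ?_ hv0 hvs hveq
      · exact ha.mul (Complex.ofRealCLM.contDiff.comp (contDiff_infty_iff_deriv.1 hφ).2)
      · simpa [hφ1] using ha0
      · refine ContDiff.add (ContDiff.mul ?_ (hun.comp (hφ.of_le (by exact_mod_cast le_top)))) hw'
        exact (contDiff_infty_iff_deriv.1 ha).2.of_le (by exact_mod_cast le_top)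
      · intro x hx
        rw [hneg x hx, hu0 x hx, deriv_eq_zero_of_eqOn_Iic hwd hw0 hx]
        simp
    have hne : ∀ y ≠ (0 : ℝ), HasDerivAt u (v y) y := by
      intro y hy
      rcases hy.lt_or_gt with h | h
      · rw [hv0 y h.le]
        refine (hasDerivAt_const y (0 : ℂ)).congr_of_eventuallyEq ?_
        filter_upwards [Iic_mem_nhds h] with z hz using hu0 z hz
      · rw [hv1 y h]
        exact (hud y h).hasDerivAt
    -- At `y = 0` differentiability follows from continuity of `u` and the existence of the limit of
    -- `u'`.
    have hall : ∀ y, HasDerivAt u (v y) y := fun y =>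
      hasDerivAt_of_hasDerivAt_of_ne' hne hun.continuous.continuousAt hvn.continuous.continuousAt y
    rw [contDiff_succ_iff_deriv]
    refine ⟨fun y => (hall y).differentiableAt, by simp, ?_⟩
    rwa [show deriv u = v from funext fun y => (hall y).deriv]

end FunctionalEquation

/-! ### Diffeomorphisms of the half line -/

theorem SmoothHalfLineMap.continuous {g : ℝ≥0 → ℝ≥0} (hg : SmoothHalfLineMap g) :
    Continuous g := by
  have h : Continuous fun x : ℝ≥0 => ((g (x : ℝ).toNNReal : ℝ≥0) : ℝ) :=
    ContinuousOn.comp_continuous (f := ((↑) : ℝ≥0 → ℝ)) (s := Ici 0)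
      (ContDiffOn.continuousOn (f := fun x : ℝ => (g x.toNNReal : ℝ)) hg)
      NNReal.continuous_coe fun x => x.2
  simp only [Real.toNNReal_coe] at h
  exact NNReal.isEmbedding_coe.continuous_iff.2 h

theorem continuous_diffHalfLine (g : DiffHalfLine) : Continuous g.1 :=
  SmoothHalfLineMap.continuous g.2.1

theorem continuous_diffHalfLine_symm (g : DiffHalfLine) : Continuous g.1.symm :=
  SmoothHalfLineMap.continuous g.2.2

/-- The extension of a self-map of `[0,∞)` to `ℝ` by the identity of `(-∞,0]`. -/
def halfLineExt (g : ℝ≥0 → ℝ≥0) (x : ℝ) : ℝ := min x 0 + g x.toNNReal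

section Expanding

variable {φ : DiffHalfLine} (hexp : ∀ x : ℝ≥0, 0 < x → x < φ.1 x)

include hexp in
theorem map_zero_of_expanding : φ.1 0 = 0 := by
  obtain ⟨y, hy⟩ := φ.1.surjective 0
  rcases eq_or_ne y 0 with rfl | h
  · exact hy
  · have h1 := hexp y (pos_iff_ne_zero.2 h)
    rw [show φ.1 y = 0 from hy] at h1
    exact absurd h1 (not_lt.2 zero_le)

include hexp in
theorem strictMono_of_expanding : StrictMono φ.1 := by
  rcases (continuous_diffHalfLine φ).strictMono_of_inj φ.1.injective with h | h
  · exact h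
  · have h1 := h (show (0 : ℝ≥0) < 1 from one_pos)
    rw [map_zero_of_expanding hexp] at h1
    exact absurd h1 (not_lt.2 zero_le)

include hexp in
theorem symm_pos_of_expanding {x : ℝ≥0} (hx : 0 < x) : 0 < φ.1.symm x := by
  rw [pos_iff_ne_zero]
  intro h
  rw [Equiv.symm_apply_eq, map_zero_of_expanding hexp] at h
  exact hx.ne' h

include hexp in
theorem symm_lt_of_expanding {x : ℝ≥0} (hx : 0 < x) : φ.1.symm x < x := by
  simpa using hexp _ (symm_pos_of_expanding hexp hx)

include hexp in
theorem exists_lt_iterate_of_expanding {x : ℝ≥0} (hx : 0 < x) (M : ℝ≥0) :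
    ∃ n, M < φ.1^[n] x :=
  exists_lt_iterate (continuous_diffHalfLine φ) (fun y hy => hexp y (hx.trans_le hy)) M

include hexp in
theorem tendsto_iterate_symm_of_expanding (x : ℝ≥0) :
    Tendsto (fun n => φ.1.symm^[n] x) atTop (𝓝 0) := by
  have h0 : φ.1.symm 0 = 0 := by rw [Equiv.symm_apply_eq, map_zero_of_expanding hexp]
  have hle : ∀ y, φ.1.symm y ≤ y := fun y => by
    rcases eq_or_ne y 0 with rfl | h
    · exact h0.le
    · exact (symm_lt_of_expanding hexp (pos_iff_ne_zero.2 h)).le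
  have hanti : Antitone fun n => φ.1.symm^[n] x := antitone_nat_of_succ_le fun n => by
    rw [Function.iterate_succ_apply']
    exact hle _
  have hlim := tendsto_atTop_ciInf hanti (OrderBot.bddBelow _)
  have hfix : Function.IsFixedPt φ.1.symm _ :=
    isFixedPt_of_tendsto_iterate hlim (continuous_diffHalfLine_symm φ).continuousAt
  rcases eq_or_ne (⨅ n, φ.1.symm^[n] x) 0 with h | h
  · rwa [h] at hlim
  · exact absurd hfix (symm_lt_of_expanding hexp (pos_iff_ne_zero.2 h)).ne

include hexp in
theorem halfLineExt_of_nonpos {x : ℝ} (hx : x ≤ 0) : halfLineExt φ.1 x = x := by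
  simp [halfLineExt, Real.toNNReal_of_nonpos hx, map_zero_of_expanding hexp, hx]

theorem halfLineExt_of_nonneg (g : ℝ≥0 → ℝ≥0) {x : ℝ} (hx : 0 ≤ x) :
    halfLineExt g x = g x.toNNReal := by
  simp [halfLineExt, hx]

include hexp in
theorem toNNReal_halfLineExt (x : ℝ) : (halfLineExt φ.1 x).toNNReal = φ.1 x.toNNReal := by
  rcases le_total x 0 with h | h
  · rw [halfLineExt_of_nonpos hexp h, Real.toNNReal_of_nonpos h, map_zero_of_expanding hexp]
  · rw [halfLineExt_of_nonneg _ h, Real.toNNReal_coe]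

include hexp in
theorem lt_halfLineExt {x : ℝ} (hx : 0 < x) : x < halfLineExt φ.1 x := by
  rw [halfLineExt_of_nonneg _ hx.le]
  have := hexp x.toNNReal (by simpa using hx)
  rw [← NNReal.coe_lt_coe, Real.coe_toNNReal _ hx.le] at this
  exact this

include hexp in
-- Tangency to infinite order is exactly what lets `φ` be glued smoothly to the identity of
-- `(-∞,0]`.
theorem contDiff_halfLineExt (hφ : TangentToIdentity φ) : ContDiff ℝ ∞ (halfLineExt φ.1) := by
  have heq : EqOn (fun x : ℝ => halfLineExt φ.1 x - x) (fun x : ℝ => (φ.1 x.toNNReal : ℝ) - x)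
      (Ici 0) := fun x hx => by simp only [halfLineExt_of_nonneg _ hx]
  have h : ContDiff ℝ ∞ fun x : ℝ => halfLineExt φ.1 x - x := by
    refine contDiff_of_flat (fun x hx => ?_) ?_ fun k => ?_
    · rw [halfLineExt_of_nonpos hexp hx, sub_self]
    · exact (ContDiffOn.sub φ.2.1 contDiffOn_id).congr heq
    · rw [iteratedDerivWithin_congr heq self_mem_Ici]
      exact hφ k
  simpa using h.add contDiff_id

include hexp in
-- Written as `β = ν⁻¹ (β ∘ φ) - ν⁻¹ w`, the equation is contracting. Since `toNNReal` sends
-- negative numbers to `0`, smoothness on all of `ℝ` includes flatness of `β` at `0`.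
theorem contDiff_of_functionalEquation (hφ : TangentToIdentity φ) {ν : ℂ} (hν : 1 < ‖ν‖)
    {β w : ℝ≥0 → ℂ} (hβ : β ∈ SmoothPos) (hw : ContDiff ℝ ∞ fun x : ℝ => w x.toNNReal)
    (hw0 : w 0 = 0) (heq : ∀ x, 0 < x → β (φ.1 x) = ν * β x + w x) :
    ContDiff ℝ ∞ fun x : ℝ => β x.toNNReal := by
  have hν0 : ν ≠ 0 := norm_pos_iff.1 (one_pos.trans hν)
  rw [contDiff_infty]
  intro n
  refine contDiff_of_contracting (contDiff_halfLineExt hexp hφ)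
    (fun x hx => halfLineExt_of_nonpos hexp hx) (fun x hx => lt_halfLineExt hexp hx) n
    (a := fun _ => ν⁻¹) (w := fun x : ℝ => -(ν⁻¹ * w x.toNNReal)) contDiff_const ?_ ?_ ?_ ?_ hβ.2 ?_
  · simpa using inv_lt_one_of_one_lt₀ hν
  · exact (contDiff_const.mul (hw.of_le (by exact_mod_cast le_top))).neg
  · intro x hx
    simp [Real.toNNReal_of_nonpos hx, hw0]
  · intro x hx
    simp [Real.toNNReal_of_nonpos hx, hβ.1]
  · intro x hx
    rw [toNNReal_halfLineExt hexp, heq _ (by simpa using hx)]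
    field_simp
    ring

/-! ### A smooth time function -/

theorem smoothHalfLineMap_iterate (g : DiffHalfLine) (n : ℕ) : SmoothHalfLineMap g.1^[n] := by
  induction n with
  | zero => exact SmoothHalfLineMap.id
  | succ n ih =>
    rw [Function.iterate_succ]
    exact ih.comp g.2.1

theorem contDiffOn_smoothTransition_iterate (g : DiffHalfLine) (n : ℕ) (a : ℝ) :
    ContDiffOn ℝ ∞ (fun x : ℝ => Real.smoothTransition ((g.1^[n] x.toNNReal : ℝ) - a)) (Ioi 0) :=
  Real.smoothTransition.contDiff.comp_contDiffOn
    (((smoothHalfLineMap_iterate g n).mono Ioi_subset_Ici_self).sub contDiffOn_const)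

include hexp in
/-- There is a smooth function `t` on `(0,∞)` with `t ∘ φ = t + 1`. -/
theorem exists_time_function : ∃ t : ℝ≥0 → ℝ,
    ContDiffOn ℝ ∞ (fun x : ℝ => t x.toNNReal) (Ioi 0) ∧ ∀ x, 0 < x → t (φ.1 x) = t x + 1 := by
  set ρ : ℝ≥0 → ℝ := fun x => Real.smoothTransition ((x : ℝ) - 1) with hρ
  have hρ0 : ∀ x : ℝ≥0, x ≤ 1 → ρ x = 0 := fun x hx =>
    Real.smoothTransition.zero_of_nonpos (by simpa using hx)
  have hρ1 : ∀ x : ℝ≥0, 2 ≤ x → ρ x = 1 := fun x hx => by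
    refine Real.smoothTransition.one_of_one_le ?_
    have : (2 : ℝ) ≤ x := by exact_mod_cast hx
    linarith
  have hmono := strictMono_of_expanding hexp
  have hle : ∀ y : ℝ≥0, y ≤ φ.1 y := fun y => by
    rcases eq_or_ne y 0 with rfl | h
    · exact zero_le
    · exact (hexp y (pos_iff_ne_zero.2 h)).le
  have hsle : ∀ y : ℝ≥0, φ.1.symm y ≤ y := fun y => by simpa using hle (φ.1.symm y)
  have hsmono : Monotone φ.1.symm := fun x y hxy => by
    rw [← hmono.le_iff_le]
    simpa using hxy
  -- the two series are finite sums, locally uniformly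
  have hA : ∀ M : ℝ≥0, ∃ N, ∀ n, N ≤ n → ∀ x ≤ M, ρ (φ.1.symm^[n] x) = 0 := by
    intro M
    obtain ⟨N, hN⟩ := eventually_atTop.1
      ((tendsto_iterate_symm_of_expanding hexp M).eventually (gt_mem_nhds one_pos))
    exact ⟨N, fun n hn x hx => hρ0 _ (((hsmono.iterate n) hx).trans (hN n hn).le)⟩
  have hB : ∀ m : ℝ≥0, 0 < m → ∃ N, ∀ n, N ≤ n → ∀ x, m ≤ x → ρ (φ.1^[n] x) = 1 := by
    intro m hm
    obtain ⟨N, hN⟩ := exists_lt_iterate_of_expanding hexp hm 2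
    refine ⟨N, fun n hn x hx => hρ1 _ (hN.le.trans ?_)⟩
    have h1 : φ.1^[N] m ≤ φ.1^[n] m :=
      (monotone_nat_of_le_succ (f := fun n => φ.1^[n] m) fun n => by
        rw [Function.iterate_succ_apply']
        exact hle _) hn
    exact h1.trans ((hmono.monotone.iterate n) hx)
  -- This is a renormalization of the divergent sum of `ρ` over a full `φ`-orbit. Replacing `x` by
  -- `φ x` moves one term across the cut, which changes the value by `ρ x + (1 - ρ x) = 1`.
  set t : ℝ≥0 → ℝ := fun x => ∑' n : ℕ, ρ (φ.1.symm^[n + 1] x) - ∑' n : ℕ, (1 - ρ (φ.1^[n] x))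
    with ht
  have htsum : ∀ (f : ℕ → ℝ) (N : ℕ), (∀ n, N ≤ n → f n = 0) →
      ∑' n, f n = ∑ n ∈ Finset.range N, f n := fun f N h =>
    tsum_eq_sum fun n hn => h n (by simpa using hn)
  refine ⟨t, ?_, ?_⟩
  · intro x₀ hx₀
    have hx₀' : (0 : ℝ) < x₀ := hx₀
    obtain ⟨N, hN⟩ := hA (x₀ + 1).toNNReal
    obtain ⟨N', hN'⟩ := hB (x₀ / 2).toNNReal (by simpa using hx₀')
    have hfin : (fun x : ℝ => t x.toNNReal) =ᶠ[𝓝[Ioi 0] x₀] fun x =>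
        ∑ n ∈ Finset.range N, ρ (φ.1.symm^[n + 1] x.toNNReal) -
          ∑ n ∈ Finset.range N', (1 - ρ (φ.1^[n] x.toNNReal)) := by
      refine Filter.Eventually.filter_mono nhdsWithin_le_nhds ?_
      filter_upwards [Ioo_mem_nhds (show x₀ / 2 < x₀ by linarith)
        (show x₀ < x₀ + 1 by linarith)] with x hx
      simp only [ht]
      rw [htsum _ N, htsum _ N']
      · intro n hn
        rw [hN' n hn _ (Real.toNNReal_le_toNNReal hx.1.le), sub_self]
      · intro n hn
        exact hN (n + 1) (by omega) _ (Real.toNNReal_le_toNNReal hx.2.le)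
    refine ContDiffWithinAt.congr_of_eventuallyEq ?_ hfin (hfin.self_of_nhdsWithin hx₀)
    have h1 : ContDiffOn ℝ ∞ (fun x : ℝ => ∑ n ∈ Finset.range N, ρ (φ.1.symm^[n + 1] x.toNNReal))
        (Ioi 0) := ContDiffOn.sum fun n _ => contDiffOn_smoothTransition_iterate φ⁻¹ (n + 1) 1
    have h2 : ContDiffOn ℝ ∞ (fun x : ℝ => ∑ n ∈ Finset.range N', (1 - ρ (φ.1^[n] x.toNNReal)))
        (Ioi 0) := ContDiffOn.sum fun n _ =>
          contDiffOn_const.sub (contDiffOn_smoothTransition_iterate φ n 1)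
    exact (h1.sub h2) x₀ hx₀
  · intro x hx
    obtain ⟨N, hN⟩ := hA (φ.1 x)
    obtain ⟨N', hN'⟩ := hB x hx
    have hx' : x ≤ φ.1 x := hle x
    simp only [ht]
    -- The longer truncations `N + 1` and `N' + 1` make the shifted finite sums agree term by term,
    -- apart from the two terms at `x` itself.
    rw [htsum (fun n => ρ (φ.1.symm^[n + 1] (φ.1 x))) (N + 1)
        fun n hn => hN _ (by omega) _ le_rfl,
      htsum (fun n => 1 - ρ (φ.1^[n] (φ.1 x))) N'
        fun n hn => by rw [hN' n hn _ hx', sub_self],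
      htsum (fun n => ρ (φ.1.symm^[n + 1] x)) N fun n hn => hN _ (by omega) _ hx',
      htsum (fun n => 1 - ρ (φ.1^[n] x)) (N' + 1)
        fun n hn => by rw [hN' n (by omega) _ le_rfl, sub_self]]
    rw [Finset.sum_range_succ' (fun n => ρ (φ.1.symm^[n + 1] (φ.1 x))),
      Finset.sum_range_succ' (fun n => 1 - ρ (φ.1^[n] x))]
    simp only [Function.iterate_succ_apply, Equiv.symm_apply_apply, Function.iterate_zero, id]
    ring

end Expanding

/-! ### The spaces `𝒵_{φ,ν}` are infinite dimensional -/

theorem contDiffOn_ofReal_comp {t : ℝ → ℝ} {s : Set ℝ} (ht : ContDiffOn ℝ ∞ t s) :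
    ContDiffOn ℝ ∞ (fun x => (t x : ℂ)) s :=
  Complex.ofRealCLM.contDiff.comp_contDiffOn ht

theorem contDiff_polynomial_eval (P : Polynomial ℂ) : ContDiff ℝ ∞ fun z : ℂ => P.eval z :=
  (P.differentiable.contDiff (n := ∞)).restrict_scalars ℝ

theorem mem_smoothPos_of_contDiffOn {f : ℝ≥0 → ℂ}
    (hf : ContDiffOn ℝ ∞ (fun x : ℝ => f x.toNNReal) (Ioi 0)) :
    (fun x => if x = 0 then 0 else f x) ∈ SmoothPos := by
  refine ⟨if_pos rfl, hf.congr fun x hx => if_neg ?_⟩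
  have : (0 : ℝ) < x := hx
  simpa using this

/-- The solutions `exp(t log ν) P(exp(2πit))` for polynomials `P`, where `t ∘ φ = t + 1`. -/
def polynomialSolution {φ : DiffHalfLine} (hexp : ∀ x : ℝ≥0, 0 < x → x < φ.1 x) {ν : ℂ}
    (hν : ν ≠ 0) {t : ℝ≥0 → ℝ} (hts : ContDiffOn ℝ ∞ (fun x : ℝ => t x.toNNReal) (Ioi 0))
    (ht : ∀ x, 0 < x → t (φ.1 x) = t x + 1) : Polynomial ℂ →ₗ[ℂ] SpaceZ φ ν where
  toFun P := ⟨fun x => if x = 0 then 0 else Complex.exp (t x * Complex.log ν) *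
      P.eval (Complex.exp (2 * Real.pi * Complex.I * t x)), by
    have htc := contDiffOn_ofReal_comp hts
    refine ⟨mem_smoothPos_of_contDiffOn
      (f := fun x => Complex.exp (t x * Complex.log ν) *
        P.eval (Complex.exp (2 * Real.pi * Complex.I * t x))) ?_, fun x hx => ?_⟩
    · exact (htc.mul contDiffOn_const).cexp.mul
        ((contDiff_polynomial_eval P).comp_contDiffOn (contDiffOn_const.mul htc).cexp)
    · have h1 : φ.1 x ≠ 0 := (hx.trans (hexp x hx)).ne'
      simp only [if_neg hx.ne', if_neg h1, ht x hx]
      push_cast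
      rw [add_mul, Complex.exp_add, one_mul, Complex.exp_log hν, mul_add, Complex.exp_add, mul_one,
        Complex.exp_two_pi_mul_I, mul_one]
      ring⟩
  map_add' P Q := by
    ext x
    by_cases hx : x = 0 <;> simp [hx, mul_add]
  map_smul' c P := by
    ext x
    by_cases hx : x = 0 <;> simp [hx, mul_left_comm]

/-- On `[1, φ 1]` the function `t` takes all values of an interval of length one, so a polynomial in
the kernel vanishes at infinitely many points of the unit circle. -/
theorem polynomialSolution_injective {φ : DiffHalfLine} (hexp : ∀ x : ℝ≥0, 0 < x → x < φ.1 x)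
    {ν : ℂ} (hν : ν ≠ 0) {t : ℝ≥0 → ℝ}
    (hts : ContDiffOn ℝ ∞ (fun x : ℝ => t x.toNNReal) (Ioi 0))
    (ht : ∀ x, 0 < x → t (φ.1 x) = t x + 1) :
    Function.Injective (polynomialSolution hexp hν hts ht) := by
  rw [injective_iff_map_eq_zero]
  intro P hP
  have hroot : ∀ x : ℝ≥0, 0 < x →
      P.eval (Complex.exp (2 * Real.pi * Complex.I * t x)) = 0 := by
    intro x hx
    have := congrFun (congrArg Subtype.val hP) x
    simpa [polynomialSolution, hx.ne'] using this
  have h1 : (1 : ℝ) ≤ φ.1 1 := by exact_mod_cast (hexp 1 one_pos).le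
  have hivt := intermediate_value_Icc h1
    (hts.continuousOn.mono fun x (hx : x ∈ Icc (1 : ℝ) _) => one_pos.trans_le hx.1)
  simp only [Real.toNNReal_one, Real.toNNReal_coe, ht 1 one_pos] at hivt
  refine P.eq_zero_of_infinite_isRoot (Infinite.mono (s := (fun s : ℝ =>
    Complex.exp (2 * Real.pi * Complex.I * s)) '' Ico (t 1) (t 1 + 1)) ?_ ?_)
  · rintro _ ⟨s, hs, rfl⟩
    obtain ⟨x, hx, rfl⟩ := hivt ⟨hs.1, hs.2.le⟩
    exact hroot _ (by simpa using one_pos.trans_le hx.1)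
  · refine Infinite.image ?_ (Ico_infinite (by linarith))
    intro s hs s' hs' h
    obtain ⟨n, hn⟩ := Complex.exp_eq_exp_iff_exists_int.1 h
    have h2 : (2 * Real.pi * Complex.I : ℂ) ≠ 0 := Complex.two_pi_I_ne_zero
    have h3 : (s : ℂ) = s' + n := by
      apply mul_left_cancel₀ h2
      linear_combination hn
    have h4 : s = s' + n := by exact_mod_cast h3
    have h5 : n < 1 := by
      have : (n : ℝ) < 1 := by linarith [hs.2, hs'.1]
      exact_mod_cast this
    have h6 : -1 < n := by
      have : (-1 : ℝ) < n := by linarith [hs.1, hs'.2]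
      exact_mod_cast this
    have h7 : n = 0 := by omega
    simpa [h7] using h4

theorem not_finiteDimensional_spaceZ {φ : DiffHalfLine} (hexp : ∀ x : ℝ≥0, 0 < x → x < φ.1 x)
    {ν : ℂ} (hν : ν ≠ 0) : ¬ FiniteDimensional ℂ (SpaceZ φ ν) := by
  intro hfin
  obtain ⟨t, hts, ht⟩ := exists_time_function hexp
  have : Module.Finite ℂ (Polynomial ℂ) :=
    Module.Finite.of_injective _ (polynomialSolution_injective hexp hν hts ht)
  exact Polynomial.not_finite this

/-! ### The extension `0 → ∏ 𝒵 → 𝒮 → 𝒵 → 0` -/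

namespace HopfData

variable (D : HopfData)

/-- The elements `((β_{1,j})_j, 0)` of `𝒮`. -/
def translations :
    Multiplicative ((j : Fin D.p) → SpaceZ D.φ (D.mu ^ (D.p - (j : ℕ)))) →* D.S where
  toFun b := ⟨(fun j => b.toAdd j, 0), fun j => (b.toAdd j).2.1, SmoothPos.zero_mem,
    fun j x hx => by
      have h0 : (0 : ℂ) ^ (D.p - (j : ℕ)) = 0 := zero_pow (by have := j.2; omega)
      simpa [h0] using (b.toAdd j).2.2 x hx, fun x _ => by simp⟩
  map_one' := rfl
  map_mul' a b := by
    refine Subtype.ext (coeffAct_injective fun x z => ?_)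
    refine Eq.trans ?_ (coeffAct_mul _ _ x z).symm
    simp only [coeffAct, toAdd_mul, Pi.add_apply, Submodule.coe_add, add_mul,
      Finset.sum_add_distrib, Pi.zero_apply, add_zero, Prod.mk.injEq, and_true]
    abel

/-- The projection `β ↦ β₂` of `𝒮`. -/
def projBeta2 : D.S →* Multiplicative (SpaceZ D.φ D.mu) where
  toFun β := Multiplicative.ofAdd ⟨β.beta2, β.2.2.1, β.2.2.2.2⟩
  map_one' := rfl
  map_mul' _ _ := rfl

/-- The equation for `β_{1,j}` is resonant: `β₂^{p-j}` already solves its homogeneous part. The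
factor `t`, which grows by `1` under `φ`, produces the missing term `c_j β₂^{p-j}`. -/
theorem projBeta2_surjective : Function.Surjective D.projBeta2 := by
  intro b
  obtain ⟨t, hts, ht⟩ := exists_time_function D.expanding
  have hμ := D.mu_ne_zero
  have hb := b.toAdd.2
  set β : ℝ≥0 → ℂ := (b.toAdd : ℝ≥0 → ℂ) with hβ
  have hpos : ∀ j : Fin D.p, D.p - (j : ℕ) ≠ 0 := fun j => by
    have := j.2
    omega
  refine ⟨⟨(fun j x => t x * ((hopfCoeff D.p D.mu j * (D.mu ^ (D.p - (j : ℕ)))⁻¹) *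
    β x ^ (D.p - (j : ℕ))), β), fun j => ⟨?_, ?_⟩, hb.1, fun j x hx => ?_, hb.2⟩, rfl⟩
  · simp [hb.1.1, hpos j]
  · exact (contDiffOn_ofReal_comp hts).mul (contDiffOn_const.mul (hb.1.2.pow _))
  · simp only [ht x hx, hb.2 x hx, mul_pow]
    have : D.mu ^ (D.p - (j : ℕ)) ≠ 0 := pow_ne_zero _ hμ
    push_cast
    field_simp

/-- The extension of `𝒵_{φ,μ}` by `𝒵_{φ,μ^p} × ⋯ × 𝒵_{φ,μ}`. -/
def solutionExtension : GroupExtension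
    (Multiplicative ((j : Fin D.p) → SpaceZ D.φ (D.mu ^ (D.p - (j : ℕ)))))
    D.S (Multiplicative (SpaceZ D.φ D.mu)) where
  inl := D.translations
  rightHom := D.projBeta2
  inl_injective a b h := by
    apply Multiplicative.toAdd.injective
    funext j
    exact Subtype.ext (congrFun (congrArg (fun s : D.S => s.1.1) h) j)
  range_inl_eq_ker_rightHom := by
    ext β
    constructor
    · rintro ⟨b, rfl⟩
      rfl
    · intro h
      have h2 : β.1.2 = 0 := congrArg (fun b => ((Multiplicative.toAdd b : SpaceZ _ _) : ℝ≥0 → ℂ)) h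
      refine ⟨Multiplicative.ofAdd fun j => ⟨β.1.1 j, β.2.1 j, fun x hx => ?_⟩,
        Subtype.ext (Prod.ext rfl h2.symm)⟩
      have h0 : (0 : ℂ) ^ (D.p - (j : ℕ)) = 0 := zero_pow (by have := j.2; omega)
      simpa [h2, h0] using β.2.2.2.1 j x hx
  rightHom_surjective := D.projBeta2_surjective

end HopfData

/-! ### The space `R̃` -/

theorem ReebCover.range_toAmbient :
    range ReebCover.toAmbient = {v : (ℂ × ℂ) × ℝ | 0 ≤ v.2 ∧ v ≠ 0} := by
  ext v
  constructor
  · rintro ⟨q, rfl⟩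
    refine ⟨q.1.2.2, fun h => q.2 ?_⟩
    have h1 : q.1.1 = 0 := congrArg Prod.fst h
    have h2 : (q.1.2 : ℝ) = 0 := congrArg Prod.snd h
    exact Prod.ext h1 (by simpa using h2)
  · rintro ⟨h1, h2⟩
    refine ⟨⟨(v.1, ⟨v.2, h1⟩), fun h => h2 ?_⟩, rfl⟩
    have h3 : v.1 = 0 := congrArg Prod.fst h
    have h4 : v.2 = 0 := congrArg (fun w : (ℂ × ℂ) × ℝ≥0 => (w.2 : ℝ)) h
    exact Prod.ext h3 h4

/-- A segment from `(O,1)` to a point of `R̃` has positive last coordinate before its end point, so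
it avoids the origin. This supplies the simple connectedness needed for lifting. -/
instance : ContractibleSpace ReebCover := by
  have hstar : StarConvex ℝ ((0 : ℂ × ℂ), (1 : ℝ)) {v : (ℂ × ℂ) × ℝ | 0 ≤ v.2 ∧ v ≠ 0} := by
    rintro v ⟨h1, h2⟩ a b ha hb hab
    refine ⟨by simpa using add_nonneg ha (mul_nonneg hb h1), fun h => ?_⟩
    have h3 : a + b * v.2 = 0 := by simpa using congrArg Prod.snd h
    have h4 : a = 0 := by nlinarith [mul_nonneg hb h1]
    have h5 : b = 1 := by linarith
    subst h4 h5
    simp at h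
    exact h2 h
  have : ContractibleSpace (range ReebCover.toAmbient) := by
    rw [ReebCover.range_toAmbient]
    exact hstar.contractibleSpace ⟨(0, 1), by simp, by simp⟩
  exact ReebCover.isEmbedding_toAmbient.toHomeomorph.contractibleSpace

instance : LocallyPathConnectedSpace ℝ≥0 := by
  have h : Topology.IsQuotientMap Real.toNNReal :=
    Topology.IsQuotientMap.of_inverse NNReal.continuous_coe continuous_real_toNNReal
      fun x => Real.toNNReal_coe
  exact h.locallyPathConnectedSpace

instance : LocallyPathConnectedSpace ReebCover :=
  (isOpen_ne (x := (0 : (ℂ × ℂ) × ℝ≥0))).locallyPathConnectedSpace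

/-- This makes a lift of an automorphism in `Aut(R,H)` the identity on all of `{x = 0}` once it
fixes one point there. -/
theorem ReebCover.isPreconnected_boundary : IsPreconnected {q : ReebCover | q.1.2 = 0} := by
  have h1 : IsPreconnected ({0}ᶜ : Set (ℂ × ℂ)) :=
    (isConnected_compl_singleton_of_one_lt_rank (by
      rw [rank_prod', Complex.rank_real_complex]
      norm_num) 0).isPreconnected
  rw [isPreconnected_iff_preconnectedSpace] at h1
  have h2 := isPreconnected_range (α := ({0}ᶜ : Set (ℂ × ℂ)))
    (f := fun z => (⟨(z.1, 0), fun h => z.2 (congrArg Prod.fst h)⟩ : ReebCover)) (by fun_prop)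
  convert h2
  ext q
  constructor
  · intro hq
    refine ⟨⟨q.1.1, fun h => q.2 (Prod.ext h hq)⟩, Subtype.ext (Prod.ext rfl hq.symm)⟩
  · rintro ⟨z, rfl⟩
    rfl

/-! ### Leafwise holomorphic smooth maps -/

theorem LeafwiseHolSmoothAt.congr {F F' : ReebCover → ReebCover} {q : ReebCover}
    (h : LeafwiseHolSmoothAt F q) (hF : F' =ᶠ[𝓝 q] F) : LeafwiseHolSmoothAt F' q := by
  obtain ⟨G, h1, h2⟩ := h
  refine ⟨G, ?_, h2⟩
  filter_upwards [h1, hF] with r hr hr'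
  rw [hr', hr]

theorem leafwiseHolSmoothAt_of_product {F : ReebCover → ReebCover} {f : (ℂ × ℂ) × ℝ → ℂ × ℂ}
    {g : ℝ≥0 → ℝ≥0} (hF : ∀ r : ReebCover, (F r).1 = (f (r.1.1, r.1.2), g r.1.2))
    (hf : ContDiff ℝ ∞ f) (hfz : ∀ x : ℝ, Differentiable ℂ fun z => f (z, x))
    (hg : SmoothHalfLineMap g) (q : ReebCover) : LeafwiseHolSmoothAt F q := by
  refine ⟨fun v => (f v, g v.2.toNNReal), Eventually.of_forall fun r => ?_, ?_, hfz _ _,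
    Eventually.of_forall fun _ => rfl⟩
  · simp [ReebCover.toAmbient, hF]
  · refine hf.contDiffWithinAt.prodMk ?_
    have h1 : ContDiffWithinAt ℝ ∞ (fun x : ℝ => (g x.toNNReal : ℝ)) (Ici 0) q.toAmbient.2 :=
      hg _ q.1.2.2
    refine h1.comp q.toAmbient contDiff_snd.contDiffWithinAt ?_
    rintro _ ⟨r, rfl⟩
    exact r.1.2.2

/-- The group of leafwise holomorphic smooth automorphisms of `R̃`. -/
def coverAut : Subgroup (Equiv.Perm ReebCover) where
  carrier := {P | (∀ q, LeafwiseHolSmoothAt P q) ∧ ∀ q, LeafwiseHolSmoothAt P.symm q}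
  mul_mem' := fun ha hb => ⟨fun q => (ha.1 _).comp (hb.1 q), fun q => (hb.2 _).comp (ha.2 q)⟩
  one_mem' := ⟨LeafwiseHolSmoothAt.id, LeafwiseHolSmoothAt.id⟩
  inv_mem' := fun ha => ⟨ha.2, ha.1⟩

theorem continuous_of_leafwiseHolSmoothAt {F : ReebCover → ReebCover}
    (h : ∀ q, LeafwiseHolSmoothAt F q) : Continuous F :=
  continuous_iff_continuousAt.2 fun q => (h q).continuousAt

namespace HopfData

variable (D : HopfData)

theorem T_mem_coverAut : D.T ∈ coverAut := by
  constructor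
  · refine leafwiseHolSmoothAt_of_product (g := D.φ.1)
      (f := fun v => (D.lam * v.1.1 + D.tau * v.1.2 ^ D.p, D.mu * v.1.2)) (fun r => rfl) ?_ ?_
      D.φ.2.1
    · fun_prop
    · intro x
      fun_prop
  · refine leafwiseHolSmoothAt_of_product (g := D.φ.1.symm)
      (f := fun v => ((v.1.1 - D.tau * (v.1.2 / D.mu) ^ D.p) / D.lam, v.1.2 / D.mu))
      (fun r => rfl) ?_ ?_ D.φ.2.2
    · simp only [div_eq_mul_inv]
      fun_prop
    · intro x
      simp only [div_eq_mul_inv]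
      fun_prop

theorem zpow_T_mem_coverAut (n : ℤ) : D.T ^ n ∈ coverAut :=
  coverAut.zpow_mem D.T_mem_coverAut n

/-! ### The covering `R̃ → R` -/

theorem not_mem_of_level {α : Type*} [LinearOrder α] {W : ReebCover → α} {a b : α}
    (hW : ∀ r, W r ≤ W (D.T r)) (hab : ∀ r, a < W r → b ≤ W (D.T r)) {n : ℕ} (hn : n ≠ 0)
    {r : ReebCover} (hr : a < W r) : ¬ W ((D.T ^ n) r) < b := by
  rw [not_lt]
  induction n with
  | zero => exact absurd rfl hn
  | succ n ih =>
    rcases eq_or_ne n 0 with rfl | h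
    · simpa using hab r hr
    · rw [pow_succ', Equiv.Perm.mul_apply]
      exact (ih h).trans (hW _)

/-- The band `{a < W < b}` is the neighbourhood: `T` pushes it beyond the level `b`, and `W` never
decreases afterwards. Negative powers reduce to positive ones by exchanging the two points. -/
theorem disjoint_translates_of_level {α : Type*} [LinearOrder α] [TopologicalSpace α]
    [OrderClosedTopology α] {W : ReebCover → α} (hWc : Continuous W) {a b : α}
    (hW : ∀ r, W r ≤ W (D.T r)) (hab : ∀ r, a < W r → b ≤ W (D.T r)) {q : ReebCover}
    (h1 : a < W q) (h2 : W q < b) :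
    ∃ U ∈ 𝓝 q, ∀ g : Subgroup.zpowers D.T, ((g • ·) '' U ∩ U).Nonempty → g = 1 := by
  refine ⟨{r | a < W r ∧ W r < b}, ?_, ?_⟩
  · exact ((isOpen_lt continuous_const hWc).inter (isOpen_lt hWc continuous_const)).mem_nhds ⟨h1, h2⟩
  · rintro ⟨_, n, rfl⟩ ⟨_, ⟨r, hr, rfl⟩, hr'⟩
    change a < W ((D.T ^ n) r) ∧ W ((D.T ^ n) r) < b at hr'
    by_contra hne
    have hn : n ≠ 0 := by
      rintro rfl
      exact hne (Subtype.ext (zpow_zero _))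
    obtain ⟨m, rfl | rfl⟩ := n.eq_nat_or_neg
    · rw [zpow_natCast] at hr'
      exact D.not_mem_of_level hW hab (by simpa using hn) hr.1 hr'.2
    · set r' := (D.T ^ (-(m : ℤ))) r with hr'_def
      have : (D.T ^ m) r' = r := by
        rw [hr'_def, ← zpow_natCast, ← Equiv.Perm.mul_apply, ← zpow_add]
        simp
      refine D.not_mem_of_level hW hab (by simpa using hn) hr'.1 ?_
      rw [this]
      exact hr.2

/-- The weight `‖z₁‖ + A‖z₂‖^p` matches the degree of the term `τ z₂^p`. With `1 < κ < ‖μ‖`, a large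
`A` lets the expansion of `z₂` absorb that term, since `‖τ‖ ≤ A(‖μ‖ - κ)`. -/
theorem exists_lyapunov : ∃ (A κ : ℝ), 0 < A ∧ 1 < κ ∧ ∀ z₁ z₂ : ℂ,
    κ * (‖z₁‖ + A * ‖z₂‖ ^ D.p) ≤
      ‖D.lam * z₁ + D.tau * z₂ ^ D.p‖ + A * ‖D.mu * z₂‖ ^ D.p := by
  set κ := (1 + ‖D.mu‖) / 2 with hκ
  have hm := D.one_lt_norm_mu
  have h1 : 1 < κ := by linarith
  have h2 : 0 < ‖D.mu‖ - κ := by linarith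
  refine ⟨‖D.tau‖ / (‖D.mu‖ - κ) + 1, κ, by positivity, h1, fun z₁ z₂ => ?_⟩
  set A := ‖D.tau‖ / (‖D.mu‖ - κ) + 1 with hA
  have hA1 : ‖D.tau‖ ≤ A * (‖D.mu‖ - κ) := by
    rw [hA, add_mul, div_mul_cancel₀ _ h2.ne']
    linarith
  have hA0 : 0 ≤ A := by positivity
  have h3 : ‖D.mu‖ ≤ ‖D.mu‖ ^ D.p :=
    le_self_pow₀ hm.le (Nat.one_le_iff_ne_zero.1 D.one_le_p)
  have h4 : ‖D.lam * z₁‖ - ‖D.tau * z₂ ^ D.p‖ ≤ ‖D.lam * z₁ + D.tau * z₂ ^ D.p‖ := by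
    simpa using norm_sub_norm_le (D.lam * z₁) (-(D.tau * z₂ ^ D.p))
  rw [norm_mul, norm_mul, norm_pow] at h4
  rw [norm_mul, mul_pow]
  have h5 : κ * ‖z₁‖ ≤ ‖D.lam‖ * ‖z₁‖ := by
    gcongr
    linarith [D.norm_mu_le]
  have h6 : ‖D.tau‖ * ‖z₂‖ ^ D.p ≤ A * (‖D.mu‖ ^ D.p - κ) * ‖z₂‖ ^ D.p := by
    gcongr
    exact hA1.trans (by gcongr)
  linarith

/-- At the boundary the level function is the weight of `exists_lyapunov`, with band `(a, κa)`; in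
the interior it is `x`, with band `(φ⁻¹ c, c)`. -/
theorem disjoint_translates (q : ReebCover) :
    ∃ U ∈ 𝓝 q, ∀ g : Subgroup.zpowers D.T, ((g • ·) '' U ∩ U).Nonempty → g = 1 := by
  rcases eq_or_ne q.1.2 0 with hq | hq
  · obtain ⟨A, κ, hA, hκ, h⟩ := D.exists_lyapunov
    set V : ReebCover → ℝ := fun r => ‖r.1.1.1‖ + A * ‖r.1.1.2‖ ^ D.p with hV
    have hVT : ∀ r, κ * V r ≤ V (D.T r) := fun r => h _ _
    have hV0 : ∀ r, 0 ≤ V r := fun r => by positivity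
    have hVq : 0 < V q := by
      refine (hV0 q).lt_of_ne' fun h0 => q.2 ?_
      have h1 : ‖q.1.1.1‖ = 0 := by
        have : 0 ≤ A * ‖q.1.1.2‖ ^ D.p := by positivity
        linarith [norm_nonneg q.1.1.1]
      have h2 : ‖q.1.1.2‖ ^ D.p = 0 := by
        have h2 : A * ‖q.1.1.2‖ ^ D.p = 0 := by
          have : V q = _ := rfl
          linarith
        exact (mul_eq_zero.1 h2).resolve_left hA.ne'
      have h3 : ‖q.1.1.2‖ = 0 := eq_zero_of_pow_eq_zero h2
      exact Prod.ext (Prod.ext (norm_eq_zero.1 h1) (norm_eq_zero.1 h3)) hq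
    obtain ⟨a, ha1, ha2⟩ := exists_between (show V q / κ < V q from div_lt_self hVq hκ)
    refine D.disjoint_translates_of_level (W := V) (a := a) (b := κ * a) (by fun_prop)
      (fun r => ?_) (fun r hr => ?_) ha2 ?_
    · exact (le_mul_of_one_le_left (hV0 r) hκ.le).trans (hVT r)
    · exact (mul_le_mul_of_nonneg_left hr.le (by linarith)).trans (hVT r)
    · rwa [div_lt_iff₀' (by linarith)] at ha1
  · have hx : 0 < q.1.2 := pos_iff_ne_zero.2 hq
    have hmono := strictMono_of_expanding D.expanding
    obtain ⟨c, hc1, hc2⟩ := exists_between (D.expanding _ hx)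
    refine D.disjoint_translates_of_level (W := fun r => r.1.2) (a := D.φ.1.symm c) (b := c)
      (by fun_prop) (fun r => ?_) (fun r hr => ?_) ?_ hc1
    · change r.1.2 ≤ D.φ.1 r.1.2
      rcases eq_or_ne r.1.2 0 with h | h
      · rw [h]
        exact zero_le
      · exact (D.expanding _ (pos_iff_ne_zero.2 h)).le
    · change c ≤ D.φ.1 r.1.2
      have := hmono.monotone hr.le
      simpa using this
    · rw [← hmono.lt_iff_lt]
      simpa using hc2

theorem proj_eq_proj_iff {q r : ReebCover} : D.proj q = D.proj r ↔ ∃ n : ℤ, (D.T ^ n) r = q := by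
  refine Quotient.eq.trans ?_
  constructor
  · rintro ⟨⟨_, n, rfl⟩, h⟩
    exact ⟨n, h⟩
  · rintro ⟨n, h⟩
    exact ⟨⟨_, n, rfl⟩, h⟩

theorem isQuotientCoveringMap_proj : IsQuotientCoveringMap D.proj (Subgroup.zpowers D.T) where
  toIsQuotientMap := isQuotientMap_quotient_mk'
  continuous_const_smul := by
    rintro ⟨_, n, rfl⟩
    exact continuous_of_leafwiseHolSmoothAt (D.zpow_T_mem_coverAut n).1
  apply_eq_iff_mem_orbit := Quotient.eq
  disjoint := D.disjoint_translates

theorem isCoveringMap_proj : IsCoveringMap D.proj :=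
  D.isQuotientCoveringMap_proj.isCoveringMap

theorem proj_T (q : ReebCover) : D.proj (D.T q) = D.proj q :=
  D.proj_eq_proj_iff.2 ⟨1, by simp⟩

theorem proj_surjective : Function.Surjective D.proj := Quotient.mk_surjective

variable {D}

/-! ### Lifts of automorphisms of `R` -/

/-- `F` is a lift of `f` to `R̃` which is the identity on the boundary. -/
structure IsRelLift (f : D.Reeb → D.Reeb) (F : ReebCover → ReebCover) : Prop where
  continuous : Continuous F
  proj_apply : ∀ q, D.proj (F q) = f (D.proj q)
  boundary : ∀ q : ReebCover, q.1.2 = 0 → F q = q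

/-- The point `((1,0),x)` of `R̃`. -/
def basePoint (x : ℝ≥0) : ReebCover := ⟨((1, 0), x), fun h => by simp at h⟩

theorem continuous_basePoint : Continuous basePoint := by
  unfold basePoint
  fun_prop

theorem IsRelLift.eq {f : D.Reeb → D.Reeb} {F F' : ReebCover → ReebCover} (h : IsRelLift f F)
    (h' : IsRelLift f F') : F = F' :=
  D.isCoveringMap_proj.eq_of_comp_eq h.continuous h'.continuous
    (funext fun q => (h.proj_apply q).trans (h'.proj_apply q).symm) (basePoint 0)
    ((h.boundary _ rfl).trans (h'.boundary _ rfl).symm)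

theorem IsRelLift.id : IsRelLift (D := D) id id := ⟨continuous_id, fun _ => rfl, fun _ _ => rfl⟩

theorem IsRelLift.comp {f g : D.Reeb → D.Reeb} {F G : ReebCover → ReebCover} (hf : IsRelLift f F)
    (hg : IsRelLift g G) : IsRelLift (f ∘ g) (F ∘ G) :=
  ⟨hf.continuous.comp hg.continuous, fun q => by simp [hf.proj_apply, hg.proj_apply],
    fun q hq => by rw [Function.comp_apply, hg.boundary q hq, hf.boundary q hq]⟩

theorem exists_isRelLift {f : D.Reeb → D.Reeb} (hf : Continuous f)
    (hfb : ∀ q ∈ D.boundary, f q = q) : ∃ F, IsRelLift f F := by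
  obtain ⟨F, ⟨h1, h2⟩, -⟩ := D.isCoveringMap_proj.existsUnique_continuousMap_lifts
    (⟨f ∘ D.proj, hf.comp D.isCoveringMap_proj.continuous⟩ : C(ReebCover, D.Reeb))
    (basePoint 0) (basePoint 0) (hfb _ ⟨basePoint 0, rfl, rfl⟩).symm
  refine ⟨F, F.continuous, fun q => congrFun h2 q, ?_⟩
  exact D.isCoveringMap_proj.eqOn_of_comp_eqOn ReebCover.isPreconnected_boundary
    F.continuous.continuousOn continuousOn_id
    (fun q hq => (congrFun h2 q).trans (hfb _ ⟨q, hq, rfl⟩)) (a := basePoint 0) rfl h1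

/-- Both sides lift `f ∘ proj` and they agree at a boundary point. -/
theorem IsRelLift.comp_T {f : D.Reeb → D.Reeb} {F : ReebCover → ReebCover} (h : IsRelLift f F)
    (q : ReebCover) : F (D.T q) = D.T (F q) := by
  have hT : Continuous D.T := continuous_of_leafwiseHolSmoothAt D.T_mem_coverAut.1
  refine congrFun (D.isCoveringMap_proj.eq_of_comp_eq (h.continuous.comp hT)
    (hT.comp h.continuous) (funext fun q => ?_) (basePoint 0) ?_) q
  · simp [h.proj_apply, proj_T]
  · simp only [Function.comp_apply]
    rw [h.boundary (basePoint 0) rfl, h.boundary _ D.φ_zero]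

/-- At `q` the lift differs from a local representative of `f` by a power of `T`; local injectivity
of the covering extends this equality to a neighbourhood. -/
theorem IsRelLift.leafwiseHolSmoothAt {f : D.Reeb → D.Reeb} {F : ReebCover → ReebCover}
    (h : IsRelLift f F) (hf : D.IsLeafwiseHolSmooth f) (q : ReebCover) :
    LeafwiseHolSmoothAt F q := by
  obtain ⟨F', h1, h2⟩ := hf q
  obtain ⟨n, hn⟩ := D.proj_eq_proj_iff.1 ((h.proj_apply q).trans h2.self_of_nhds)
  have h3 : LeafwiseHolSmoothAt ((D.T ^ n) ∘ F') q := ((D.zpow_T_mem_coverAut n).1 _).comp h1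
  refine h3.congr ?_
  obtain ⟨U, hU, hq, hinj⟩ := D.isCoveringMap_proj.isLocalHomeomorph.isLocallyInjective (F q)
  have hU1 := h.continuous.continuousAt.eventually (hU.mem_nhds hq)
  have hU2 := h3.continuousAt.eventually (hU.mem_nhds (by simpa [hn] using hq))
  filter_upwards [hU1, hU2, h2] with r hr1 hr2 hr3
  refine hinj hr1 hr2 ?_
  rw [h.proj_apply, hr3]
  exact (D.proj_eq_proj_iff.2 ⟨n, rfl⟩).symm

/-- For `x > 0` the leaf is all of `ℂ²`, hence connected, and the transverse component is locally
constant on it. -/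
theorem ReebCover.level_eq_of_leafwiseHolSmoothAt {F : ReebCover → ReebCover}
    (hF : ∀ q, LeafwiseHolSmoothAt F q) (hb : ∀ q : ReebCover, q.1.2 = 0 → F q = q)
    (q : ReebCover) : (F q).1.2 = (F (basePoint q.1.2)).1.2 := by
  rcases eq_or_ne q.1.2 0 with hq | hq
  · rw [hb q hq, hb (basePoint q.1.2) hq]
    rfl
  · set x := q.1.2 with hx
    set i : ℂ × ℂ → ReebCover := fun z => ⟨(z, x), fun h => hq (congrArg Prod.snd h)⟩ with hi
    have hic : Continuous i := by
      rw [hi]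
      fun_prop
    have hloc : IsLocallyConstant fun z => (F (i z)).1.2 := by
      rw [IsLocallyConstant.iff_eventually_eq]
      intro z
      obtain ⟨G, h1, -, -, h4⟩ := hF (i z)
      filter_upwards [hic.continuousAt.eventually h1, h4] with z' hz hz'
      have h5 : ((F (i z')).1.2 : ℝ) = (F (i z)).1.2 :=
        (congrArg Prod.snd hz).trans (hz'.trans (congrArg Prod.snd h1.self_of_nhds).symm)
      exact_mod_cast h5
    exact hloc.apply_eq_of_preconnectedSpace q.1.1 (1, 0)

theorem ReebCover.smoothHalfLineMap_level {F : ReebCover → ReebCover}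
    (hF : ∀ q, LeafwiseHolSmoothAt F q) : SmoothHalfLineMap fun x => (F (basePoint x)).1.2 := by
  intro x hx
  obtain ⟨G, h1, h2, -⟩ := hF (basePoint x.toNNReal)
  have hamb : ∀ y : ℝ, 0 ≤ y → (basePoint y.toNNReal).toAmbient = ((1, 0), y) := fun y hy => by
    simp [ReebCover.toAmbient, basePoint, hy]
  rw [hamb x hx] at h2
  have h3 : ContDiffWithinAt ℝ ∞ (fun y : ℝ => (G ((1, 0), y)).2) (Ici 0) x := by
    refine contDiff_snd.contDiffWithinAt.comp x (h2.comp x (by fun_prop) ?_) (mapsTo_univ _ _)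
    exact fun y hy => ⟨_, hamb y hy⟩
  have h4 : ∀ᶠ y in 𝓝 x, (F (basePoint y.toNNReal)).toAmbient =
      G (basePoint y.toNNReal).toAmbient :=
    (continuous_basePoint.comp continuous_real_toNNReal).continuousAt.eventually h1
  have h5 : (fun y : ℝ => ((F (basePoint y.toNNReal)).1.2 : ℝ)) =ᶠ[𝓝[Ici 0] x]
      fun y => (G ((1, 0), y)).2 := by
    filter_upwards [h4.filter_mono nhdsWithin_le_nhds, self_mem_nhdsWithin] with y hy hy0
    rw [hamb y hy0] at hy
    exact congrArg Prod.snd hy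
  exact h3.congr_of_eventuallyEq h5 (h5.self_of_nhdsWithin hx)

end HopfData

/-! ### Polynomial coefficients -/

/-- The Vandermonde matrix at `0, …, d - 1` is invertible, so each coefficient is a fixed linear
combination of values of the polynomial. -/
theorem contDiffOn_coeff_of_contDiffOn_sum {d : ℕ} {s : Set ℝ} {a : Fin d → ℝ → ℂ}
    (h : ∀ t : ℂ, ContDiffOn ℝ ∞ (fun x => ∑ j, a j x * t ^ (j : ℕ)) s) (j : Fin d) :
    ContDiffOn ℝ ∞ (a j) s := by
  set M := Matrix.vandermonde fun i : Fin d => ((i : ℕ) : ℂ) with hM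
  have hdet : IsUnit M.det := by
    rw [isUnit_iff_ne_zero, hM, Matrix.det_vandermonde_ne_zero_iff]
    intro i k hik
    exact Fin.ext (Nat.cast_injective (R := ℂ) hik)
  have ha : ∀ x, a j x = ∑ i : Fin d, M⁻¹ j i * ∑ k : Fin d, a k x * ((i : ℕ) : ℂ) ^ (k : ℕ) := by
    intro x
    have h1 : M⁻¹.mulVec (M.mulVec fun k => a k x) = fun k => a k x := by
      rw [Matrix.mulVec_mulVec, Matrix.nonsing_inv_mul _ hdet, Matrix.one_mulVec]
    have h2 := congrFun h1 j
    simp only [Matrix.mulVec, dotProduct] at h2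
    rw [← h2]
    refine Finset.sum_congr rfl fun i _ => ?_
    congr 1
    exact Finset.sum_congr rfl fun k _ => mul_comm _ _
  rw [show a j = fun x => ∑ i : Fin d, M⁻¹ j i * ∑ k : Fin d, a k x * ((i : ℕ) : ℂ) ^ (k : ℕ) from
    funext ha]
  exact ContDiffOn.sum fun i _ => contDiffOn_const.mul (h i)

theorem coeff_eq_of_forall_sum_eq {d : ℕ} {a b : Fin d → ℂ}
    (h : ∀ t : ℂ, ∑ j, a j * t ^ (j : ℕ) = ∑ j, b j * t ^ (j : ℕ)) : a = b := by
  have hp : (∑ i : Fin d, Polynomial.monomial (i : ℕ) (a i)) =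
      ∑ i : Fin d, Polynomial.monomial (i : ℕ) (b i) := by
    refine Polynomial.funext fun w => ?_
    simpa [Polynomial.eval_finsetSum] using h w
  funext j
  have := congrArg (fun q => Polynomial.coeff q (j : ℕ)) hp
  simpa [Polynomial.finsetSum_coeff, Polynomial.coeff_monomial, Fin.val_inj] using this

theorem iteratedDeriv_sum_mul_pow_zero {d k : ℕ} (hk : d ≤ k) (q : Fin d → ℂ) :
    iteratedDeriv k (fun t : ℂ => ∑ j, q j * t ^ (j : ℕ)) 0 = 0 := by
  rw [iteratedDeriv_fun_sum fun i _ => by fun_prop]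
  refine Finset.sum_eq_zero fun j _ => ?_
  rw [iteratedDeriv_const_mul_field, iteratedDeriv_fun_pow_zero, if_neg (by omega), Nat.cast_zero,
    mul_zero]

theorem eq_sum_of_iteratedDeriv_eq_zero {f : ℂ → ℂ} (hf : Differentiable ℂ f) {d : ℕ}
    (h : ∀ k, d ≤ k → iteratedDeriv k f 0 = 0) (t : ℂ) :
    f t = ∑ j : Fin d, ((Nat.factorial j : ℂ)⁻¹ * iteratedDeriv j f 0) * t ^ (j : ℕ) := by
  rw [← Complex.taylorSeries_eq_of_entire' 0 t hf, tsum_eq_sum (s := Finset.range d),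
    ← Fin.sum_univ_eq_sum_range
      (fun n => (Nat.factorial n : ℂ)⁻¹ * iteratedDeriv n f 0 * (t - 0) ^ n)]
  · simp
  · intro k hk
    rw [h k (by simpa using hk)]
    simp

theorem add_pow_sub_pow_eq_sum (p : ℕ) (t b : ℂ) :
    (t + b) ^ p - t ^ p = ∑ j : Fin p, ((p.choose j : ℂ) * b ^ (p - (j : ℕ))) * t ^ (j : ℕ) := by
  rw [add_pow, Finset.sum_range_succ,
    Fin.sum_univ_eq_sum_range (fun j => ((p.choose j : ℂ) * b ^ (p - j)) * t ^ j)]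
  simp only [Nat.sub_self, pow_zero, mul_one, Nat.choose_self, Nat.cast_one, add_sub_cancel_right]
  exact Finset.sum_congr rfl fun j _ => by ring

/-! ### Equivariant families of holomorphic maps of `ℂ²` -/

namespace HopfData

variable (D : HopfData)

/-- The expansion `G(z₁, z₂) = (λ z₁ + τ z₂^p, μ z₂)` of `ℂ²`. -/
def hopfMap (z : ℂ × ℂ) : ℂ × ℂ := (D.lam * z.1 + D.tau * z.2 ^ D.p, D.mu * z.2)

/-- Each application of `T⁻¹` shrinks the weight of `exists_lyapunov` by the factor `κ⁻¹`. -/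
theorem tendsto_iterate_ambientT_symm (w : (ℂ × ℂ) × ℝ≥0) :
    Tendsto (fun n => (D.ambientT.symm^[n] w).1) atTop (𝓝 0) := by
  obtain ⟨A, κ, hA, hκ, h⟩ := D.exists_lyapunov
  set V : ℂ × ℂ → ℝ := fun z => ‖z.1‖ + A * ‖z.2‖ ^ D.p with hV
  have hκ0 : 0 < κ := by linarith
  have hstep : ∀ v : (ℂ × ℂ) × ℝ≥0, V (D.ambientT.symm v).1 ≤ κ⁻¹ * V v.1 := by
    intro v
    have h1 : κ * V (D.ambientT.symm v).1 ≤ V (D.ambientT (D.ambientT.symm v)).1 := h _ _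
    rw [Equiv.apply_symm_apply] at h1
    rwa [le_inv_mul_iff₀ hκ0]
  have hn : ∀ n, V (D.ambientT.symm^[n] w).1 ≤ κ⁻¹ ^ n * V w.1 := by
    intro n
    induction n with
    | zero => simp
    | succ n ih =>
      rw [Function.iterate_succ_apply', pow_succ', mul_assoc]
      exact (hstep _).trans (by gcongr)
  have hlim : Tendsto (fun n => V (D.ambientT.symm^[n] w).1) atTop (𝓝 0) := by
    refine squeeze_zero (fun n => by positivity) hn ?_
    have := (tendsto_pow_atTop_nhds_zero_of_lt_one (inv_nonneg.2 hκ0.le)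
      (inv_lt_one_of_one_lt₀ hκ)).mul_const (V w.1)
    rwa [zero_mul] at this
  have hp0 : D.p ≠ 0 := Nat.one_le_iff_ne_zero.1 D.one_le_p
  have h1 : Tendsto (fun n => (D.ambientT.symm^[n] w).1.1) atTop (𝓝 0) := by
    refine squeeze_zero_norm (fun n => ?_) hlim
    have : 0 ≤ A * ‖(D.ambientT.symm^[n] w).1.2‖ ^ D.p := by positivity
    simp only [hV]
    linarith
  have h2 : Tendsto (fun n => (D.ambientT.symm^[n] w).1.2) atTop (𝓝 0) := by
    have h3 : Tendsto (fun n => ‖(D.ambientT.symm^[n] w).1.2‖ ^ D.p) atTop (𝓝 0) := by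
      refine squeeze_zero (fun n => by positivity) (fun n => ?_)
        (by simpa using hlim.const_mul A⁻¹)
      rw [le_inv_mul_iff₀ hA]
      simp only [hV]
      linarith [norm_nonneg (D.ambientT.symm^[n] w).1.1]
    rw [tendsto_zero_iff_norm_tendsto_zero]
    rw [Metric.tendsto_nhds] at h3 ⊢
    intro ε hε
    filter_upwards [h3 (ε ^ D.p) (by positivity)] with n hn
    rw [dist_zero_right, Real.norm_of_nonneg (by positivity)] at hn
    rw [dist_zero_right, norm_norm]
    exact lt_of_pow_lt_pow_left₀ _ hε.le hn
  exact h1.prodMk_nhds h2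

/-- A function on `ℂ² × (0,∞)` which does not increase along `T` and which tends to `0` at
`x = 0`, uniformly near the origin of `ℂ²`, is nonpositive. -/
theorem nonpos_of_le_along_T {K : ℝ≥0 → ℂ × ℂ → ℝ}
    (hK : ∀ x, 0 < x → ∀ z, K (D.φ.1 x) (D.hopfMap z) ≤ K x z) {r : ℝ} (hr : 0 < r)
    (hsmall : ∀ ε > 0, ∀ᶠ x in 𝓝[>] 0, ∀ z : ℂ × ℂ, ‖z‖ ≤ r → K x z ≤ ε)
    {x : ℝ≥0} (hx : 0 < x) (z : ℂ × ℂ) : K x z ≤ 0 := by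
  set w : (ℂ × ℂ) × ℝ≥0 := (z, x) with hw
  have hpos : ∀ n, 0 < (D.ambientT.symm^[n] w).2 := by
    intro n
    induction n with
    | zero => exact hx
    | succ n ih =>
      rw [Function.iterate_succ_apply']
      exact symm_pos_of_expanding D.expanding ih
  -- Going back along the orbit does not decrease `K`, while the orbit ends up where `K ≤ ε`.
  have hle : ∀ n, K x z ≤ K (D.ambientT.symm^[n] w).2 (D.ambientT.symm^[n] w).1 := by
    intro n
    induction n with
    | zero => exact le_rfl
    | succ n ih =>
      refine ih.trans ?_
      rw [Function.iterate_succ_apply']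
      set v := D.ambientT.symm^[n] w with hv
      have h1 := hK (D.ambientT.symm v).2 (symm_pos_of_expanding D.expanding (hpos n))
        (D.ambientT.symm v).1
      have h2 : D.φ.1 (D.ambientT.symm v).2 = v.2 :=
        congrArg Prod.snd (D.ambientT.apply_symm_apply v)
      have h3 : D.hopfMap (D.ambientT.symm v).1 = v.1 :=
        congrArg Prod.fst (D.ambientT.apply_symm_apply v)
      rwa [h2, h3] at h1
  have hsnd : ∀ n, (D.ambientT.symm^[n] w).2 = D.φ.1.symm^[n] x := by
    intro n
    induction n with
    | zero => rfl
    | succ n ih =>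
      rw [Function.iterate_succ_apply', Function.iterate_succ_apply', ← ih]
      rfl
  have hlim2 : Tendsto (fun n => (D.ambientT.symm^[n] w).2) atTop (𝓝[>] 0) := by
    refine tendsto_nhdsWithin_iff.2 ⟨?_, Eventually.of_forall hpos⟩
    simp only [hsnd]
    exact tendsto_iterate_symm_of_expanding D.expanding x
  have hlim1 := (D.tendsto_iterate_ambientT_symm w).norm
  rw [norm_zero] at hlim1
  refine le_of_forall_pos_le_add fun ε hε => ?_
  obtain ⟨n, hn1, hn2⟩ := ((hlim2.eventually (hsmall ε hε)).and
    (hlim1.eventually (gt_mem_nhds hr))).exists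
  rw [zero_add]
  exact (hle n).trans (hn1 _ hn2.le)

/-- An equivariant family of entire functions which tends to `0` at `x = 0` consists of
polynomials. -/
theorem eq_sum_of_equivariant {P : ℝ≥0 → ℂ → ℂ} {d : ℕ} {c : ℂ} {q : ℝ≥0 → Fin d → ℂ}
    (hP : ∀ x, 0 < x → Differentiable ℂ (P x))
    (heq : ∀ x, 0 < x → ∀ t, P (D.φ.1 x) (D.mu * t) = c * P x t + ∑ j, q x j * t ^ (j : ℕ))
    (hc : ‖c‖ ≤ ‖D.mu‖ ^ d)
    (hsmall : ∀ ε > 0, ∀ᶠ x in 𝓝[>] 0, ∀ t, ‖t‖ ≤ 1 → ‖P x t‖ ≤ ε)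
    {x : ℝ≥0} (hx : 0 < x) (t : ℂ) :
    P x t = ∑ j : Fin d, ((Nat.factorial j : ℂ)⁻¹ * iteratedDeriv j (P x) 0) * t ^ (j : ℕ) := by
  refine eq_sum_of_iteratedDeriv_eq_zero (hP x hx) (fun k hk => ?_) t
  have hfac : (0 : ℝ) < Nat.factorial k := by exact_mod_cast Nat.factorial_pos k
  rw [← norm_le_zero_iff]
  -- The `k`-th derivative at `0` of the equation, `k ≥ d`, no longer sees the polynomial term: the
  -- chain rule gives `μ^k` on the left against `c` on the right, and `‖c‖ ≤ ‖μ‖^k`. Smallness as `x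
  -- → 0` is Cauchy's estimate on the unit circle.
  refine D.nonpos_of_le_along_T (K := fun x _ => ‖iteratedDeriv k (P x) 0‖) (fun x hx _ => ?_)
    one_pos (fun ε hε => ?_) hx 0
  · have h1 := iteratedDeriv_comp_const_mul (n := k)
      ((hP _ (hx.trans (D.expanding x hx))).contDiff) D.mu
    rw [funext (heq x hx)] at h1
    have h2 := congrFun h1 0
    rw [iteratedDeriv_fun_add (contDiff_const.mul (hP x hx).contDiff).contDiffAt (by fun_prop),
      iteratedDeriv_const_mul_field, iteratedDeriv_sum_mul_pow_zero hk, add_zero, mul_zero] at h2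
    have h3 := congrArg norm h2
    rw [norm_mul, norm_mul, norm_pow] at h3
    have hm : 0 < ‖D.mu‖ ^ k := pow_pos (one_pos.trans D.one_lt_norm_mu) k
    have h4 : ‖c‖ ≤ ‖D.mu‖ ^ k := hc.trans (pow_le_pow_right₀ D.one_lt_norm_mu.le hk)
    refine le_of_mul_le_mul_left ?_ hm
    rw [← h3]
    gcongr
  · filter_upwards [hsmall (ε / Nat.factorial k) (by positivity), self_mem_nhdsWithin]
      with y hy hy0 _ _
    have h1 := Complex.norm_iteratedDeriv_le_of_forall_mem_sphere_norm_le (c := 0) k one_pos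
      (hP y hy0).diffContOnCl fun t ht => hy t (by simpa using (mem_sphere_zero_iff_norm.1 ht).le)
    rwa [one_pow, div_one, mul_div_cancel₀ _ hfac.ne'] at h1

/-- An equivariant family of functions on `ℂ²` which is entire in `z₁` and tends to `0` at `x = 0`
does not depend on `z₁`. -/
theorem eq_of_equivariant {H : ℝ≥0 → ℂ × ℂ → ℂ} {c : ℂ} {q : ℝ≥0 → ℂ → ℂ}
    (hH : ∀ x, 0 < x → ∀ t, Differentiable ℂ fun s => H x (s, t))
    (heq : ∀ x, 0 < x → ∀ z, H (D.φ.1 x) (D.hopfMap z) = c * H x z + q x z.2)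
    (hc : ‖c‖ ≤ ‖D.lam‖)
    (hsmall : ∀ ε > 0, ∀ᶠ x in 𝓝[>] 0, ∀ z : ℂ × ℂ, ‖z‖ ≤ 1 → ‖H x z‖ ≤ ε)
    {x : ℝ≥0} (hx : 0 < x) (s t : ℂ) : H x (s, t) = H x (0, t) := by
  refine is_const_of_deriv_eq_zero (hH x hx t) (fun s => ?_) s 0
  rw [← norm_le_zero_iff]
  -- Differentiating in `z₁` removes `q` and gives the factor `λ` on the left against `c` on the
  -- right. For `‖z‖ ≤ 1/2` the circle of radius `1/2` about `z₁` stays in the unit ball, where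
  -- Cauchy's estimate applies.
  refine D.nonpos_of_le_along_T (K := fun x z => ‖deriv (fun s => H x (s, z.2)) z.1‖)
    (fun x hx z => ?_) (r := 1 / 2) (by norm_num) (fun ε hε => ?_) hx (s, t)
  · have hx' := hx.trans (D.expanding x hx)
    have h1 : (fun s => H (D.φ.1 x) (D.lam * s + D.tau * z.2 ^ D.p, D.mu * z.2)) =
        fun s => c * H x (s, z.2) + q x z.2 := funext fun s => heq x hx (s, z.2)
    have h2 : HasDerivAt (fun s => D.lam * s + D.tau * z.2 ^ D.p) D.lam z.1 := by
      simpa using ((hasDerivAt_id z.1).const_mul D.lam).add_const (D.tau * z.2 ^ D.p)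
    have h3 := HasDerivAt.comp (h₂ := fun s => H (D.φ.1 x) (s, D.mu * z.2)) z.1
      (hH _ hx' (D.mu * z.2) _).hasDerivAt h2
    have h4 := (((hH x hx z.2) z.1).hasDerivAt.const_mul c).add_const (q x z.2)
    rw [← h1] at h4
    have h5 := congrArg norm (h3.unique h4)
    rw [norm_mul, norm_mul] at h5
    have hl : 0 < ‖D.lam‖ := norm_pos_iff.2 D.lam_ne_zero
    change ‖deriv (fun s => H (D.φ.1 x) (s, D.mu * z.2)) (D.lam * z.1 + D.tau * z.2 ^ D.p)‖ ≤ _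
    refine le_of_mul_le_mul_right ?_ hl
    rw [h5, mul_comm ‖c‖]
    gcongr
  · filter_upwards [hsmall (ε / 2) (by positivity), self_mem_nhdsWithin] with y hy hy0 z hz
    have hz1 : ‖z.1‖ ≤ 1 / 2 := (norm_fst_le z).trans hz
    have hz2 : ‖z.2‖ ≤ 1 / 2 := (norm_snd_le z).trans hz
    have h1 := Complex.norm_deriv_le_of_forall_mem_sphere_norm_le (c := z.1) (R := 1 / 2)
      (C := ε / 2) (by norm_num) (hH y hy0 z.2).diffContOnCl fun s hs => by
        refine hy _ ?_
        rw [Prod.norm_mk]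
        refine max_le ?_ (by linarith)
        have h2 : ‖s - z.1‖ = 1 / 2 := mem_sphere_iff_norm.1 hs
        have h3 := norm_add_le (s - z.1) z.1
        rw [sub_add_cancel] at h3
        linarith
    linarith

/-- A smooth family of entire self-maps of `ℂ²` which commutes with `T` and tends to the identity
at `x = 0` is given by an element of `𝒮`. -/
theorem exists_solution_of_equivariant (hτ : D.tau = 1) (hlam : D.lam = D.mu ^ D.p)
    {Φ : ℝ≥0 → ℂ × ℂ → ℂ × ℂ} (hΦ : ∀ x, 0 < x → Differentiable ℂ (Φ x))
    (hsmooth : ∀ z, ContDiffOn ℝ ∞ (fun x : ℝ => Φ x.toNNReal z) (Ioi 0))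
    (heq : ∀ x, 0 < x → ∀ z, Φ (D.φ.1 x) (D.hopfMap z) = D.hopfMap (Φ x z))
    (hsmall : ∀ ε > 0, ∀ᶠ x in 𝓝[>] 0, ∀ z : ℂ × ℂ, ‖z‖ ≤ 1 → ‖Φ x z - z‖ ≤ ε) :
    ∃ β : D.S, ∀ x, 0 < x → ∀ z, Φ x z = coeffAct β.1 x z := by
  have hp0 : D.p ≠ 0 := Nat.one_le_iff_ne_zero.1 D.one_le_p
  have heq1 : ∀ x, 0 < x → ∀ z, (Φ (D.φ.1 x) (D.hopfMap z)).1 =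
      D.lam * (Φ x z).1 + D.tau * (Φ x z).2 ^ D.p :=
    fun x hx z => congrArg Prod.fst (heq x hx z)
  have heq2 : ∀ x, 0 < x → ∀ z, (Φ (D.φ.1 x) (D.hopfMap z)).2 = D.mu * (Φ x z).2 :=
    fun x hx z => congrArg Prod.snd (heq x hx z)
  have hd1 : ∀ x, 0 < x → Differentiable ℂ fun z => (Φ x z).1 := fun x hx => (hΦ x hx).fst
  have hd2 : ∀ x, 0 < x → Differentiable ℂ fun z => (Φ x z).2 := fun x hx => (hΦ x hx).snd
  have hsmall1 : ∀ ε > 0, ∀ᶠ x in 𝓝[>] 0, ∀ z : ℂ × ℂ, ‖z‖ ≤ 1 → ‖(Φ x z).1 - z.1‖ ≤ ε :=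
    fun ε hε => (hsmall ε hε).mono fun x hx z hz => (norm_fst_le (Φ x z - z)).trans (hx z hz)
  have hsmall2 : ∀ ε > 0, ∀ᶠ x in 𝓝[>] 0, ∀ z : ℂ × ℂ, ‖z‖ ≤ 1 → ‖(Φ x z).2 - z.2‖ ≤ ε :=
    fun ε hε => (hsmall ε hε).mono fun x hx z hz => (norm_snd_le (Φ x z - z)).trans (hx z hz)
  -- the second component
  set b : ℝ≥0 → ℂ := fun x => (Φ x (0, 0)).2 with hb
  have hind2 : ∀ x, 0 < x → ∀ s t, (Φ x (s, t)).2 = (Φ x (0, t)).2 := by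
    intro x hx s t
    have := D.eq_of_equivariant (H := fun x z => (Φ x z).2 - z.2) (c := D.mu) (q := 0)
      (fun x hx t =>
        ((hd2 x hx).comp (by fun_prop : Differentiable ℂ fun s : ℂ => (s, t))).sub_const t)
      (fun x hx z => ?_) D.norm_mu_le hsmall2 hx s t
    · simpa using this
    · rw [heq2 x hx z]
      simp only [hopfMap, Pi.zero_apply]
      ring
  have hsnd : ∀ x, 0 < x → ∀ z, (Φ x z).2 = z.2 + b x := by
    intro x hx z
    -- With `c = μ` the bound `‖c‖ ≤ ‖μ‖^d` holds for `d = 1`, so only a constant survives.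
    have h0 : ∀ t, (Φ x (0, t)).2 - t = _ := D.eq_sum_of_equivariant
      (P := fun x t => (Φ x (0, t)).2 - t) (d := 1) (c := D.mu) (q := 0)
      (fun x hx => ((hd2 x hx).comp (by fun_prop : Differentiable ℂ fun t : ℂ => ((0 : ℂ), t))).sub
        differentiable_id)
      (fun x hx t => ?_) (by simp) (fun ε hε => ?_) hx
    · have h1 := h0 z.2
      have h2 := h0 0
      simp only [Finset.univ_unique, Fin.default_eq_zero, Finset.sum_singleton, Fin.val_zero,
        pow_zero, mul_one] at h1 h2
      rw [← h2, sub_zero] at h1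
      have h3 : (Φ x z).2 = (Φ x (0, z.2)).2 := hind2 x hx z.1 z.2
      rw [h3, sub_eq_iff_eq_add.1 h1, add_comm]
    · have h1 := heq2 x hx (0, t)
      simp only [hopfMap] at h1
      have h2 := hind2 _ (hx.trans (D.expanding x hx)) (D.lam * 0 + D.tau * t ^ D.p) (D.mu * t)
      simp only [← h2, h1, Pi.zero_apply, zero_mul, Finset.sum_const_zero, add_zero]
      ring
    · filter_upwards [hsmall2 ε hε] with y hy t ht
      exact hy (0, t) (by simpa [Prod.norm_mk] using ht)
  have hbφ : ∀ x, 0 < x → b (D.φ.1 x) = D.mu * b x := by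
    intro x hx
    simpa [hopfMap, hp0] using heq2 x hx (0, 0)
  -- the first component
  have hexpand : ∀ x, 0 < x → ∀ z, (Φ (D.φ.1 x) (D.hopfMap z)).1 - (D.hopfMap z).1 =
      D.lam * ((Φ x z).1 - z.1) + D.tau * ((z.2 + b x) ^ D.p - z.2 ^ D.p) := by
    intro x hx z
    rw [heq1 x hx z, hsnd x hx z, hopfMap]
    ring
  have hind1 : ∀ x, 0 < x → ∀ s t, (Φ x (s, t)).1 - s = (Φ x (0, t)).1 := by
    intro x hx s t
    have := D.eq_of_equivariant (H := fun x z => (Φ x z).1 - z.1) (c := D.lam)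
      (q := fun x t => D.tau * ((t + b x) ^ D.p - t ^ D.p))
      (fun x hx t => ((hd1 x hx).comp (by fun_prop : Differentiable ℂ fun s : ℂ => (s, t))).sub
        differentiable_id)
      hexpand le_rfl hsmall1 hx s t
    simpa using this
  have hP : ∀ x, 0 < x → ∀ t, (Φ (D.φ.1 x) (0, D.mu * t)).1 = D.lam * (Φ x (0, t)).1 +
      ∑ j : Fin D.p, ((D.p.choose j : ℂ) * b x ^ (D.p - (j : ℕ))) * t ^ (j : ℕ) := by
    intro x hx t
    have h1 := hexpand x hx (0, t)
    rw [hτ, one_mul, add_pow_sub_pow_eq_sum] at h1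
    simp only [sub_zero] at h1
    rw [← h1]
    exact (hind1 _ (hx.trans (D.expanding x hx)) _ _).symm
  set a : Fin D.p → ℝ≥0 → ℂ := fun j x =>
    (Nat.factorial j : ℂ)⁻¹ * iteratedDeriv j (fun t => (Φ x (0, t)).1) 0 with ha
  have hPa : ∀ x, 0 < x → ∀ t, (Φ x (0, t)).1 = ∑ j, a j x * t ^ (j : ℕ) := by
    intro x hx t
    -- Since `‖λ‖ = ‖μ‖^p`, all powers of `z₂` below the `p`-th may survive.
    refine D.eq_sum_of_equivariant (P := fun x t => (Φ x (0, t)).1) (c := D.lam)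
      (fun x hx => (hd1 x hx).comp (by fun_prop : Differentiable ℂ fun t : ℂ => ((0 : ℂ), t)))
      hP (by rw [hlam, norm_pow]) (fun ε hε => ?_) hx t
    filter_upwards [hsmall1 ε hε] with y hy t ht
    simpa using hy (0, t) (by simpa [Prod.norm_mk] using ht)
  have hfst : ∀ x, 0 < x → ∀ z, (Φ x z).1 = z.1 + ∑ j, a j x * z.2 ^ (j : ℕ) := by
    intro x hx z
    rw [← hPa x hx, ← hind1 x hx z.1 z.2]
    simp
  have haφ : ∀ x, 0 < x → ∀ j, a j (D.φ.1 x) =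
      D.mu ^ (D.p - (j : ℕ)) * a j x + hopfCoeff D.p D.mu j * b x ^ (D.p - (j : ℕ)) := by
    intro x hx j
    -- Coefficients of `t^j` are compared. Dividing by the `μ^j` that comes from `(μt)^j` turns `λ`
    -- into `μ^{p-j}` and `binom(p,j)` into `c_j`.
    have h1 := congrFun (coeff_eq_of_forall_sum_eq
      (a := fun j : Fin D.p => a j (D.φ.1 x) * D.mu ^ (j : ℕ))
      (b := fun j : Fin D.p => D.lam * a j x + (D.p.choose j : ℂ) * b x ^ (D.p - (j : ℕ)))
      fun t => ?_) j
    · have hμj : D.mu ^ (j : ℕ) ≠ 0 := pow_ne_zero _ D.mu_ne_zero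
      have h2 : D.lam = D.mu ^ (D.p - (j : ℕ)) * D.mu ^ (j : ℕ) := by
        rw [hlam, ← pow_add, Nat.sub_add_cancel j.2.le]
      simp only [h2] at h1
      apply mul_right_cancel₀ hμj
      rw [h1, hopfCoeff]
      field_simp
    · have h1 := hP x hx t
      rw [hPa x hx, hPa _ (hx.trans (D.expanding x hx))] at h1
      simp only [add_mul, Finset.sum_add_distrib, mul_assoc, ← Finset.mul_sum]
      simp only [mul_pow, mul_assoc] at h1
      exact h1
  -- smoothness
  have hbs : ContDiffOn ℝ ∞ (fun x : ℝ => b x.toNNReal) (Ioi 0) := (hsmooth (0, 0)).snd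
  have has : ∀ j, ContDiffOn ℝ ∞ (fun x : ℝ => a j x.toNNReal) (Ioi 0) := by
    refine contDiffOn_coeff_of_contDiffOn_sum (a := fun j (x : ℝ) => a j x.toNNReal) fun t => ?_
    refine ((hsmooth (0, t)).fst).congr fun x hx => (hPa _ (by simpa using hx) t).symm
  have hφpos : ∀ x, 0 < x → D.φ.1 x ≠ 0 := fun x hx => (hx.trans (D.expanding x hx)).ne'
  -- Nothing is known of `Φ` at `x = 0`, so the coefficients are reset to `0` there.
  refine ⟨⟨(fun j x => if x = 0 then 0 else a j x, fun x => if x = 0 then 0 else b x),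
    fun j => mem_smoothPos_of_contDiffOn (has j), mem_smoothPos_of_contDiffOn hbs,
    fun j x hx => ?_, fun x hx => ?_⟩, fun x hx z => ?_⟩
  · simp only [if_neg hx.ne', if_neg (hφpos x hx), haφ x hx j]
  · simp only [if_neg hx.ne', if_neg (hφpos x hx), hbφ x hx]
  · simp only [coeffAct, if_neg hx.ne']
    exact Prod.ext (hfst x hx z) (hsnd x hx z)

end HopfData

namespace HopfData

variable (D : HopfData)

/-! ### The group of lifts -/

/-- The leafwise holomorphic smooth automorphisms of `R̃` which commute with `T` and are the
identity on the boundary. -/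
def relCoverAut : Subgroup (Equiv.Perm ReebCover) where
  carrier := {P | P ∈ coverAut ∧ Commute P D.T ∧ ∀ q : ReebCover, q.1.2 = 0 → P q = q}
  mul_mem' := fun {a b} ha hb => ⟨coverAut.mul_mem ha.1 hb.1, ha.2.1.mul_left hb.2.1,
    fun q hq => by rw [Equiv.Perm.mul_apply, hb.2.2 q hq, ha.2.2 q hq]⟩
  one_mem' := ⟨coverAut.one_mem, Commute.one_left _, fun _ _ => rfl⟩
  inv_mem' := fun {a} ha => ⟨coverAut.inv_mem ha.1, ha.2.1.inv_left,
    fun q hq => (Equiv.symm_apply_eq a).2 (ha.2.2 q hq).symm⟩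

variable {D}

theorem proj_apply_eq_of_commute {P : Equiv.Perm ReebCover} (hP : Commute P D.T) {q r : ReebCover}
    (h : D.proj q = D.proj r) : D.proj (P q) = D.proj (P r) := by
  obtain ⟨n, rfl⟩ := D.proj_eq_proj_iff.1 h
  refine D.proj_eq_proj_iff.2 ⟨n, ?_⟩
  have := hP.zpow_right n
  exact (DFunLike.congr_fun this r).symm

/-- The self-map of `R` induced by a transformation of `R̃` which commutes with `T`. -/
def descendFun (P : Equiv.Perm ReebCover) (hP : Commute P D.T) : D.Reeb → D.Reeb :=
  Quotient.lift (fun q => D.proj (P q)) fun _ _ h =>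
    proj_apply_eq_of_commute hP (Quotient.sound h)

theorem isLeafwiseHolSmooth_descendFun {P : Equiv.Perm ReebCover} (hP : Commute P D.T)
    (h : ∀ q, LeafwiseHolSmoothAt P q) : D.IsLeafwiseHolSmooth (descendFun P hP) :=
  fun q => ⟨P, h q, Eventually.of_forall fun _ => rfl⟩

theorem continuous_descendFun {P : Equiv.Perm ReebCover} (hP : Commute P D.T)
    (h : ∀ q, LeafwiseHolSmoothAt P q) : Continuous (descendFun P hP) :=
  D.isQuotientCoveringMap_proj.toIsQuotientMap.continuous_iff.2
    (D.isCoveringMap_proj.continuous.comp (continuous_of_leafwiseHolSmoothAt h))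

theorem descendFun_symm_descendFun {P : Equiv.Perm ReebCover} (hP : Commute P D.T)
    (hP' : Commute P.symm D.T) (q : D.Reeb) : descendFun P.symm hP' (descendFun P hP q) = q := by
  obtain ⟨q, rfl⟩ := D.proj_surjective q
  exact congrArg D.proj (P.symm_apply_apply q)

theorem descendFun_descendFun_symm {P : Equiv.Perm ReebCover} (hP : Commute P D.T)
    (hP' : Commute P.symm D.T) (q : D.Reeb) : descendFun P hP (descendFun P.symm hP' q) = q := by
  obtain ⟨q, rfl⟩ := D.proj_surjective q
  exact congrArg D.proj (P.apply_symm_apply q)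

variable (D)

/-- An automorphism of `R̃` which commutes with `T` and is the identity on the boundary induces an
automorphism of `R` relative to `H`. -/
def descend : D.relCoverAut →* D.AutRel where
  toFun P := ⟨⟨
    { toFun := descendFun P.1 P.2.2.1
      invFun := descendFun P.1.symm P.2.2.1.inv_left
      left_inv := descendFun_symm_descendFun _ _
      right_inv := descendFun_descendFun_symm _ _
      continuous_toFun := continuous_descendFun _ P.2.1.1
      continuous_invFun := continuous_descendFun _ P.2.1.2 },
    isLeafwiseHolSmooth_descendFun P.2.2.1 P.2.1.1,
    isLeafwiseHolSmooth_descendFun P.2.2.1.inv_left P.2.1.2⟩, by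
    rintro _ ⟨q, hq, rfl⟩
    exact congrArg D.proj (P.2.2.2 q hq)⟩
  map_one' := by
    refine Subtype.ext (Subtype.ext (Homeomorph.ext fun q => ?_))
    obtain ⟨q, rfl⟩ := D.proj_surjective q
    rfl
  map_mul' P Q := by
    refine Subtype.ext (Subtype.ext (Homeomorph.ext fun q => ?_))
    obtain ⟨q, rfl⟩ := D.proj_surjective q
    rfl

variable {D}

theorem isRelLift_descend (P : D.relCoverAut) :
    IsRelLift ((D.descend P : D.Aut) : D.Reeb ≃ₜ D.Reeb) P.1 :=
  ⟨continuous_of_leafwiseHolSmoothAt P.2.1.1, fun _ => rfl, P.2.2.2⟩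

variable (D)

/-- Lifts of `f` and `f⁻¹` compose to lifts of the identity, which are trivial by uniqueness; so a
lift is invertible. -/
theorem descend_bijective : Function.Bijective D.descend := by
  constructor
  · intro P Q h
    have h1 := isRelLift_descend P
    rw [h] at h1
    exact Subtype.ext (DFunLike.coe_injective (h1.eq (isRelLift_descend Q)))
  · intro f
    obtain ⟨F, hF⟩ := exists_isRelLift (f : D.Aut).1.continuous f.2
    obtain ⟨F', hF'⟩ := exists_isRelLift ((f⁻¹ : D.AutRel) : D.Aut).1.continuous (f⁻¹).2
    have h1 : F' ∘ F = id := (hF'.comp hF).eq (by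
      have : ((f⁻¹ : D.AutRel) : D.Aut).1 ∘ (f : D.Aut).1 = id :=
        funext fun q => (f : D.Aut).1.symm_apply_apply q
      rw [this]
      exact IsRelLift.id)
    have h2 : F ∘ F' = id := (hF.comp hF').eq (by
      have : (f : D.Aut).1 ∘ ((f⁻¹ : D.AutRel) : D.Aut).1 = id :=
        funext fun q => (f : D.Aut).1.apply_symm_apply q
      rw [this]
      exact IsRelLift.id)
    refine ⟨⟨⟨F, F', congrFun h1, congrFun h2⟩, ⟨hF.leafwiseHolSmoothAt (f : D.Aut).2.1,
      hF'.leafwiseHolSmoothAt (f : D.Aut).2.2⟩, Equiv.ext hF.comp_T, hF.boundary⟩, ?_⟩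
    refine Subtype.ext (Subtype.ext (Homeomorph.ext fun q => ?_))
    obtain ⟨q, rfl⟩ := D.proj_surjective q
    exact hF.proj_apply q

/-- Taking lifts identifies `Aut(R,H)` with a group of transformations of `R̃`. -/
def descendEquiv : D.relCoverAut ≃* D.AutRel :=
  MulEquiv.ofBijective D.descend D.descend_bijective

/-! ### The transverse component -/

variable {D}

theorem relCoverAut_level (P : D.relCoverAut) (q : ReebCover) :
    (P.1 q).1.2 = (P.1 (basePoint q.1.2)).1.2 :=
  ReebCover.level_eq_of_leafwiseHolSmoothAt P.2.1.1 P.2.2.2 q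

/-- The transverse component of an automorphism of `R̃`, as a permutation of `[0,∞)`. -/
def levelPerm (P : D.relCoverAut) : Equiv.Perm ℝ≥0 where
  toFun x := (P.1 (basePoint x)).1.2
  invFun x := ((P⁻¹).1 (basePoint x)).1.2
  left_inv x := by
    refine (relCoverAut_level P⁻¹ (P.1 (basePoint x))).symm.trans ?_
    exact congrArg (fun q : ReebCover => q.1.2) (P.1.symm_apply_apply (basePoint x))
  right_inv x := by
    refine (relCoverAut_level P ((P⁻¹).1 (basePoint x))).symm.trans ?_
    exact congrArg (fun q : ReebCover => q.1.2) (P.1.apply_symm_apply (basePoint x))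

variable (D)

/-- The transverse component of an automorphism of `R̃`, as an element of `Z_φ`. -/
def level : D.relCoverAut →* D.Centralizer where
  toFun P := ⟨⟨levelPerm P, ReebCover.smoothHalfLineMap_level P.2.1.1,
      ReebCover.smoothHalfLineMap_level P.2.1.2⟩, by
    rw [Subgroup.mem_centralizer_singleton_iff]
    refine Subtype.ext (Equiv.ext fun x => ?_)
    change (P.1 (basePoint (D.φ.1 x))).1.2 = (D.T (P.1 (basePoint x))).1.2
    have h1 : P.1 (D.T (basePoint x)) = D.T (P.1 (basePoint x)) :=
      DFunLike.congr_fun P.2.2.1 (basePoint x)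
    rw [← h1]
    exact (relCoverAut_level P (D.T (basePoint x))).symm⟩
  map_one' := rfl
  map_mul' P Q := Subtype.ext (Subtype.ext (Equiv.ext fun x =>
    relCoverAut_level P (Q.1 (basePoint x))))

theorem level_apply (P : D.relCoverAut) (q : ReebCover) :
    (P.1 q).1.2 = (D.level P : DiffHalfLine).1 q.1.2 :=
  relCoverAut_level P q

variable {D} in
-- `η 0` is a fixed point of `φ`, and `0` is the only one.
theorem centralizer_apply_zero (η : D.Centralizer) : (η : DiffHalfLine).1 0 = 0 := by
  have h1 := Subgroup.mem_centralizer_singleton_iff.1 η.2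
  have h2 : (η : DiffHalfLine).1 (D.φ.1 0) = D.φ.1 ((η : DiffHalfLine).1 0) :=
    DFunLike.congr_fun (congrArg Subtype.val h1) 0
  rw [D.φ_zero] at h2
  by_contra h
  exact (D.expanding _ (pos_iff_ne_zero.2 h)).ne h2

variable {D} in
theorem productMap_ne_zero (η : D.Centralizer) (q : ReebCover) :
    (q.1.1, (η : DiffHalfLine).1 q.1.2) ≠ 0 := by
  intro h
  have h1 : q.1.1 = 0 := congrArg Prod.fst h
  refine q.2 (Prod.ext h1 ?_)
  exact (η : DiffHalfLine).1.injective
    ((congrArg Prod.snd h).trans (centralizer_apply_zero η).symm)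

/-- Because `T` is the product `G × φ`, the map `id × η` commutes with it. -/
theorem level_surjective : Function.Surjective D.level := by
  intro η
  set P : Equiv.Perm ReebCover :=
    { toFun := fun q => ⟨(q.1.1, (η : DiffHalfLine).1 q.1.2), productMap_ne_zero η q⟩
      invFun := fun q => ⟨(q.1.1, ((η⁻¹ : D.Centralizer) : DiffHalfLine).1 q.1.2),
        productMap_ne_zero η⁻¹ q⟩
      left_inv := fun q => Subtype.ext (Prod.ext rfl ((η : DiffHalfLine).1.symm_apply_apply _))
      right_inv := fun q => Subtype.ext (Prod.ext rfl ((η : DiffHalfLine).1.apply_symm_apply _)) }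
    with hP
  have hsm : P ∈ coverAut :=
    ⟨leafwiseHolSmoothAt_of_product (f := Prod.fst) (fun _ => rfl) contDiff_fst
        (fun _ => differentiable_id) (η : DiffHalfLine).2.1,
      leafwiseHolSmoothAt_of_product (f := Prod.fst) (fun _ => rfl) contDiff_fst
        (fun _ => differentiable_id) (η : DiffHalfLine).2.2⟩
  have hcomm : Commute P D.T := by
    refine Equiv.ext fun q => Subtype.ext (Prod.ext rfl ?_)
    have h1 := Subgroup.mem_centralizer_singleton_iff.1 η.2
    exact DFunLike.congr_fun (congrArg Subtype.val h1) q.1.2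
  refine ⟨⟨P, hsm, hcomm, fun q hq => Subtype.ext (Prod.ext rfl ?_)⟩, rfl⟩
  change (η : DiffHalfLine).1 q.1.2 = q.1.2
  rw [hq, centralizer_apply_zero]

/-! ### Shears -/

variable {D}

theorem S.contDiff_beta2 (hφ : TangentToIdentity D.φ) (β : D.S) :
    ContDiff ℝ ∞ fun x : ℝ => β.beta2 x.toNNReal :=
  contDiff_of_functionalEquation D.expanding hφ D.one_lt_norm_mu (w := 0) β.2.2.1 contDiff_const
    rfl fun x hx => (β.2.2.2.2 x hx).trans (add_zero _).symm

/-- The inhomogeneous term is a positive power of `β₂`, already known to be smooth and zero at `0`.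
-/
theorem S.contDiff_beta1 (hφ : TangentToIdentity D.φ) (β : D.S) (j : Fin D.p) :
    ContDiff ℝ ∞ fun x : ℝ => β.beta1 j x.toNNReal := by
  have hj : D.p - (j : ℕ) ≠ 0 := by
    have := j.2
    omega
  refine contDiff_of_functionalEquation D.expanding hφ (ν := D.mu ^ (D.p - (j : ℕ)))
    (w := fun x => hopfCoeff D.p D.mu j * β.beta2 x ^ (D.p - (j : ℕ))) ?_ (β.2.1 j)
    (contDiff_const.mul ((S.contDiff_beta2 hφ β).pow _)) ?_ (β.2.2.2.1 j)
  · rw [norm_pow]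
    exact one_lt_pow₀ D.one_lt_norm_mu hj
  · have : β.beta2 0 = 0 := β.2.2.1.1
    simp [this, hj]

theorem S.leafwiseHolSmoothAt_shear (hφ : TangentToIdentity D.φ) (β : D.S) (q : ReebCover) :
    LeafwiseHolSmoothAt β.shear q := by
  refine leafwiseHolSmoothAt_of_product (g := id)
    (f := fun v => (v.1.1 + ∑ j : Fin D.p, β.beta1 j v.2.toNNReal * v.1.2 ^ (j : ℕ),
      v.1.2 + β.beta2 v.2.toNNReal)) (fun r => ?_) ?_ (fun x => ?_) SmoothHalfLineMap.id q
  · simp only [Real.toNNReal_coe]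
    rfl
  · have h1 := fun j => (S.contDiff_beta1 hφ β j).comp
      (contDiff_snd : ContDiff ℝ ∞ (Prod.snd : (ℂ × ℂ) × ℝ → ℝ))
    have h2 := (S.contDiff_beta2 hφ β).comp
      (contDiff_snd : ContDiff ℝ ∞ (Prod.snd : (ℂ × ℂ) × ℝ → ℝ))
    simp only [Function.comp_def] at h1 h2
    exact (contDiff_fst.fst.add (ContDiff.sum fun j _ => (h1 j).mul
      (contDiff_fst.snd.pow _))).prodMk (contDiff_fst.snd.add h2)
  · have h (j : Fin D.p) : Differentiable ℂ fun z : ℂ × ℂ =>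
        β.beta1 j x.toNNReal * z.2 ^ (j : ℕ) := (differentiable_snd.pow _).const_mul _
    have h' : Differentiable ℂ fun z : ℂ × ℂ => z.2 + β.beta2 x.toNNReal :=
      differentiable_snd.add_const _
    exact (differentiable_fst.add (Differentiable.fun_sum fun j _ => h j)).prodMk h'

theorem S.shear_mul (β γ : D.S) (q : ReebCover) : (β * γ).shear q = β.shear (γ.shear q) :=
  Subtype.ext (Prod.ext (coeffAct_mul β.1 γ.1 q.1.2 q.1.1) rfl)

theorem S.shear_one (q : ReebCover) : (1 : D.S).shear q = q := by
  refine Subtype.ext (Prod.ext (Prod.ext ?_ ?_) rfl)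
  · change q.1.1.1 + ∑ j : Fin D.p, (0 : ℂ) * q.1.1.2 ^ (j : ℕ) = q.1.1.1
    simp
  · exact add_zero q.1.1.2

theorem S.shear_of_level_zero (β : D.S) (q : ReebCover) (hq : q.1.2 = 0) : β.shear q = q := by
  have h1 : ∀ j, β.beta1 j 0 = 0 := fun j => (β.2.1 j).1
  have h2 : β.beta2 0 = 0 := β.2.2.1.1
  refine Subtype.ext (Prod.ext (Prod.ext ?_ ?_) rfl)
  · simp [S.shear, hq, h1]
  · simp [S.shear, hq, h2]

/-- The terms `c_j β₂^{p-j}` are the ones that cancel the binomial expansion of `(z₂ + β₂)^p -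
z₂^p`; `λ = μ^p` makes the linear factors match. -/
theorem S.shear_T (hτ : D.tau = 1) (hlam : D.lam = D.mu ^ D.p) (β : D.S) (q : ReebCover) :
    β.shear (D.T q) = D.T (β.shear q) := by
  rcases eq_or_ne q.1.2 0 with hq | hq
  · rw [β.shear_of_level_zero q hq, β.shear_of_level_zero (D.T q)]
    change D.φ.1 q.1.2 = 0
    rw [hq, D.φ_zero]
  · have hx : 0 < q.1.2 := pos_iff_ne_zero.2 hq
    obtain ⟨⟨⟨z₁, z₂⟩, x⟩, hne⟩ := q
    have hβ2 : β.beta2 (D.φ.1 x) = D.mu * β.beta2 x := β.2.2.2.2 x hx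
    have hβ1 : ∀ j : Fin D.p, β.beta1 j (D.φ.1 x) * (D.mu * z₂) ^ (j : ℕ) =
        D.lam * (β.beta1 j x * z₂ ^ (j : ℕ)) +
          (D.p.choose j * β.beta2 x ^ (D.p - (j : ℕ))) * z₂ ^ (j : ℕ) := by
      intro j
      have h1 : β.beta1 j (D.φ.1 x) = D.mu ^ (D.p - (j : ℕ)) * β.beta1 j x +
        hopfCoeff D.p D.mu j * β.beta2 x ^ (D.p - (j : ℕ)) := β.2.2.2.1 j x hx
      have hμj : D.mu ^ (j : ℕ) ≠ 0 := pow_ne_zero _ D.mu_ne_zero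
      have h2 : D.lam = D.mu ^ (D.p - (j : ℕ)) * D.mu ^ (j : ℕ) := by
        rw [hlam, ← pow_add, Nat.sub_add_cancel j.2.le]
      rw [h1, h2, hopfCoeff, mul_pow]
      field_simp
    refine Subtype.ext (Prod.ext (Prod.ext ?_ ?_) rfl)
    · change D.lam * z₁ + D.tau * z₂ ^ D.p +
          ∑ j : Fin D.p, β.beta1 j (D.φ.1 x) * (D.mu * z₂) ^ (j : ℕ) =
        D.lam * (z₁ + ∑ j : Fin D.p, β.beta1 j x * z₂ ^ (j : ℕ)) +
          D.tau * (z₂ + β.beta2 x) ^ D.p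
      simp only [hβ1, Finset.sum_add_distrib, ← Finset.mul_sum, ← add_pow_sub_pow_eq_sum, hτ]
      ring
    · change D.mu * z₂ + β.beta2 (D.φ.1 x) = D.mu * (z₂ + β.beta2 x)
      rw [hβ2, mul_add]

/-- The shears form a subgroup of the automorphisms of `R̃`. -/
def shearHom (hφ : TangentToIdentity D.φ) (hτ : D.tau = 1) (hlam : D.lam = D.mu ^ D.p) :
    D.S →* D.relCoverAut where
  toFun β := ⟨
    { toFun := β.shear
      invFun := β⁻¹.shear
      left_inv := fun q => by rw [← S.shear_mul, inv_mul_cancel, S.shear_one]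
      right_inv := fun q => by rw [← S.shear_mul, mul_inv_cancel, S.shear_one] },
    ⟨β.leafwiseHolSmoothAt_shear hφ, β⁻¹.leafwiseHolSmoothAt_shear hφ⟩,
    Equiv.ext (β.shear_T hτ hlam), β.shear_of_level_zero⟩
  map_one' := Subtype.ext (Equiv.ext S.shear_one)
  map_mul' β γ := Subtype.ext (Equiv.ext (S.shear_mul β γ))

theorem S.shear_injective {β γ : D.S} (h : ∀ q, β.shear q = γ.shear q) : β = γ := by
  refine Subtype.ext (coeffAct_injective fun x z => ?_)
  rcases eq_or_ne x 0 with rfl | hx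
  · have h1 : ∀ (β : D.S) j, β.1.1 j 0 = 0 := fun β j => (β.2.1 j).1
    have h2 : ∀ β : D.S, β.1.2 0 = 0 := fun β => β.2.2.1.1
    simp [coeffAct, h1, h2]
  · exact congrArg (fun q : ReebCover => q.1.1) (h ⟨(z, x), fun h => hx (congrArg Prod.snd h)⟩)

/-! ### Automorphisms of `R̃` which preserve every leaf -/

/-- The `ℂ²`-component of a self-map of `R̃`, with value `0` at the missing point. -/
def fiberMap (F : ReebCover → ReebCover) (x : ℝ≥0) (z : ℂ × ℂ) : ℂ × ℂ :=
  open Classical in if h : (z, x) = 0 then 0 else (F ⟨(z, x), h⟩).1.1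

theorem fiberMap_apply (F : ReebCover → ReebCover) (q : ReebCover) :
    fiberMap F q.1.2 q.1.1 = (F q).1.1 :=
  dif_neg q.2

theorem eventually_norm_fiberMap_sub_le_of_ne_zero {F : ReebCover → ReebCover}
    (hF : Continuous F) (hb : ∀ q : ReebCover, q.1.2 = 0 → F q = q) {ε : ℝ} (hε : 0 < ε)
    {z : ℂ × ℂ} (hz : z ≠ 0) :
    ∀ᶠ v : ℝ≥0 × (ℂ × ℂ) in 𝓝 (0, z), ‖fiberMap F v.1 v.2 - v.2‖ ≤ ε := by
  set q : ReebCover := ⟨(z, 0), fun h => hz (congrArg Prod.fst h)⟩ with hq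
  have h1 : ∀ᶠ r in 𝓝 q, ‖(F r).1.1 - r.1.1‖ < ε := by
    have hc : Continuous fun r : ReebCover => ‖(F r).1.1 - r.1.1‖ := by fun_prop
    refine hc.continuousAt.eventually (gt_mem_nhds ?_)
    simpa [hb q rfl] using hε
  have hemb : Topology.IsOpenEmbedding (Subtype.val : ReebCover → (ℂ × ℂ) × ℝ≥0) :=
    (isOpen_ne (x := (0 : (ℂ × ℂ) × ℝ≥0))).isOpenEmbedding_subtypeVal
  have h2 : ∀ᶠ w in 𝓝 q.1, ‖fiberMap F w.2 w.1 - w.1‖ ≤ ε := by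
    rw [← hemb.map_nhds_eq, eventually_map]
    filter_upwards [h1] with r hr
    rw [fiberMap_apply]
    exact hr.le
  exact (continuous_swap.tendsto ((0 : ℝ≥0), z)).eventually h2

theorem differentiable_fiberMap {F : ReebCover → ReebCover} (hF : ∀ q, LeafwiseHolSmoothAt F q)
    {x : ℝ≥0} (hx : 0 < x) : Differentiable ℂ (fiberMap F x) := by
  intro z
  have hne : ∀ z : ℂ × ℂ, (z, x) ≠ 0 := fun z h => hx.ne' (congrArg Prod.snd h)
  set i : ℂ × ℂ → ReebCover := fun z => ⟨(z, x), hne z⟩ with hi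
  have hic : Continuous i := by
    rw [hi]
    fun_prop
  obtain ⟨G, h1, -, h3, -⟩ := hF (i z)
  refine h3.congr_of_eventuallyEq ?_
  filter_upwards [hic.continuousAt.eventually h1] with w hw
  exact (fiberMap_apply F (i w)).trans (congrArg Prod.fst hw)

theorem contDiffOn_fiberMap {F : ReebCover → ReebCover} (hF : ∀ q, LeafwiseHolSmoothAt F q)
    (z : ℂ × ℂ) : ContDiffOn ℝ ∞ (fun x : ℝ => fiberMap F x.toNNReal z) (Ioi 0) := by
  intro x hx
  have hx0 : (0 : ℝ) < x := hx
  set q : ReebCover := ⟨(z, x.toNNReal), fun h => by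
    have h1 : x.toNNReal = 0 := congrArg Prod.snd h
    rw [Real.toNNReal_eq_zero] at h1
    exact h1.not_gt hx0⟩ with hq
  obtain ⟨G, h1, h2, -⟩ := hF q
  have hqa : q.toAmbient = (z, x) := by simp [ReebCover.toAmbient, hq, hx0.le]
  rw [hqa] at h2
  have hmem : ∀ y : ℝ, 0 < y → (z, y) ∈ range ReebCover.toAmbient := fun y hy => by
    rw [ReebCover.range_toAmbient]
    exact ⟨hy.le, fun h => hy.ne' (congrArg Prod.snd h)⟩
  have h3 : ContDiffWithinAt ℝ ∞ (fun y : ℝ => (G (z, y)).1) (Ioi 0) x :=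
    contDiff_fst.contDiffWithinAt.comp x
      (h2.comp x (by fun_prop) fun y hy => hmem y hy) (mapsTo_univ _ _)
  have h4 : ∀ᶠ v in 𝓝[range ReebCover.toAmbient] (z, x),
      ∀ r : ReebCover, r.toAmbient = v → (F r).toAmbient = G v := by
    rw [← hqa, ← ReebCover.isEmbedding_toAmbient.map_nhds_eq, eventually_map]
    filter_upwards [h1] with r hr r' hr'
    rw [← hr, ReebCover.isEmbedding_toAmbient.injective hr']
  have h5 : Tendsto (fun y : ℝ => (z, y)) (𝓝[Ioi 0] x) (𝓝[range ReebCover.toAmbient] (z, x)) := by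
    refine tendsto_nhdsWithin_iff.2 ⟨?_, ?_⟩
    · exact ((by fun_prop : Continuous fun y : ℝ => (z, y)).tendsto x).mono_left nhdsWithin_le_nhds
    · filter_upwards [self_mem_nhdsWithin] with y hy using hmem y hy
  have h6 : (fun y : ℝ => fiberMap F y.toNNReal z) =ᶠ[𝓝[Ioi 0] x] fun y => (G (z, y)).1 := by
    filter_upwards [h5.eventually h4, self_mem_nhdsWithin] with y hy hy0
    obtain ⟨r, hr⟩ := hmem y hy0
    have h7 := fiberMap_apply F r
    have h8 : r.1.1 = z := congrArg Prod.fst hr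
    have h9 : r.1.2 = y.toNNReal := by
      rw [← Real.toNNReal_coe (r := r.1.2)]
      exact congrArg (fun v : (ℂ × ℂ) × ℝ => v.2.toNNReal) hr
    rw [h8, h9] at h7
    rw [h7]
    exact congrArg Prod.fst (hy r hr)
  exact h3.congr_of_eventuallyEq h6 (h6.self_of_nhdsWithin hx)

/-- Continuity of `F` says nothing near the missing point `(O,0)`. On the unit sphere, which avoids
it, compactness gives a uniform bound, and for `x > 0` the maximum principle carries the bound into
the ball. -/
theorem eventually_norm_fiberMap_sub_le {F : ReebCover → ReebCover}
    (hF : ∀ q, LeafwiseHolSmoothAt F q) (hb : ∀ q : ReebCover, q.1.2 = 0 → F q = q) {ε : ℝ}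
    (hε : 0 < ε) : ∀ᶠ x in 𝓝[>] (0 : ℝ≥0), ∀ z : ℂ × ℂ, ‖z‖ ≤ 1 → ‖fiberMap F x z - z‖ ≤ ε := by
  have h1 := (isCompact_sphere (0 : ℂ × ℂ) 1).eventually_forall_of_forall_eventually
    (x₀ := (0 : ℝ≥0)) (P := fun x z => ‖fiberMap F x z - z‖ ≤ ε) fun z hz =>
      eventually_norm_fiberMap_sub_le_of_ne_zero (continuous_of_leafwiseHolSmoothAt hF) hb hε
        (ne_zero_of_mem_unit_sphere ⟨z, hz⟩)
  filter_upwards [h1.filter_mono nhdsWithin_le_nhds, self_mem_nhdsWithin] with x hx hx0 z hz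
  refine Complex.norm_le_of_forall_mem_frontier_norm_le (U := Metric.ball (0 : ℂ × ℂ) 1)
    (f := fun z => fiberMap F x z - z) Metric.isBounded_ball
    ((differentiable_fiberMap hF hx0).sub differentiable_id).diffContOnCl ?_ ?_
  · rw [frontier_ball _ one_ne_zero]
    exact hx
  · rw [closure_ball _ one_ne_zero]
    simpa using hz

/-- A lift that preserves every level is an equivariant family of entire maps tending to the
identity, so `exists_solution_of_equivariant` makes it a shear for `x > 0`; on `x = 0` both are the
identity. -/
theorem range_shearHom_eq_ker_level (hφ : TangentToIdentity D.φ) (hτ : D.tau = 1)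
    (hlam : D.lam = D.mu ^ D.p) : (shearHom hφ hτ hlam).range = D.level.ker := by
  ext P
  constructor
  · rintro ⟨β, rfl⟩
    rfl
  · intro hP
    have hlev : ∀ q, (P.1 q).1.2 = q.1.2 := fun q => by
      rw [D.level_apply P q, MonoidHom.mem_ker.1 hP]
      rfl
    have heq : ∀ x, 0 < x → ∀ z,
        fiberMap P.1 (D.φ.1 x) (D.hopfMap z) = D.hopfMap (fiberMap P.1 x z) := by
      intro x hx z
      set q : ReebCover := ⟨(z, x), fun h => hx.ne' (congrArg Prod.snd h)⟩
      have h1 : P.1 (D.T q) = D.T (P.1 q) := DFunLike.congr_fun P.2.2.1 q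
      have h2 := fiberMap_apply P.1 (D.T q)
      rw [h1] at h2
      exact h2.trans (congrArg D.hopfMap (fiberMap_apply P.1 q).symm)
    obtain ⟨β, hβ⟩ := D.exists_solution_of_equivariant hτ hlam (Φ := fiberMap P.1)
      (fun x hx => differentiable_fiberMap P.2.1.1 hx) (contDiffOn_fiberMap P.2.1.1) heq
      fun ε hε => eventually_norm_fiberMap_sub_le P.2.1.1 P.2.2.2 hε
    refine ⟨β, Subtype.ext (Equiv.ext fun q => ?_)⟩
    change β.shear q = P.1 q
    rcases eq_or_ne q.1.2 0 with hq | hq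
    · rw [β.shear_of_level_zero q hq, P.2.2.2 q hq]
    · refine Subtype.ext (Prod.ext ?_ (hlev q).symm)
      rw [← fiberMap_apply P.1, hβ _ (pos_iff_ne_zero.2 hq)]
      rfl

/-- The extension of `Z_φ` by `𝒮` given by `Aut(R,H)`. -/
def autExtension (hφ : TangentToIdentity D.φ) (hτ : D.tau = 1) (hlam : D.lam = D.mu ^ D.p) :
    GroupExtension D.S D.AutRel D.Centralizer where
  inl := D.descend.comp (shearHom hφ hτ hlam)
  rightHom := D.level.comp D.descendEquiv.symm.toMonoidHom
  inl_injective β γ h := by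
    have h1 := D.descend_bijective.1 h
    exact S.shear_injective fun q =>
      DFunLike.congr_fun (congrArg Subtype.val h1) q
  range_inl_eq_ker_rightHom := by
    ext f
    have h1 : f ∈ (D.level.comp D.descendEquiv.symm.toMonoidHom).ker ↔
        D.descendEquiv.symm f ∈ (shearHom hφ hτ hlam).range := by
      rw [range_shearHom_eq_ker_level]
      rfl
    rw [h1]
    constructor
    · rintro ⟨β, rfl⟩
      exact ⟨β, (D.descendEquiv.symm_apply_apply _).symm⟩
    · rintro ⟨β, hβ⟩
      refine ⟨β, ?_⟩
      rw [MonoidHom.comp_apply, hβ]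
      exact D.descendEquiv.apply_symm_apply f
  rightHom_surjective := D.level_surjective.comp D.descendEquiv.symm.surjective

end HopfData

end

/-! ### The two extensions and the infinite dimensional spaces -/

theorem theorem3p13 (D : HopfData) (hφ : TangentToIdentity D.φ) (hp : 2 ≤ D.p)
    (hτ : D.tau = 1) (hlam : D.lam = D.mu ^ D.p) :
    -- the extension `1 → 𝒮_{φ,μ}(c) → Aut(R,H) → Z_φ → 1`
    (∃ E : GroupExtension D.S D.AutRel D.Centralizer,
      (∀ (β : D.S) (q : ReebCover),
        ((E.inl β : D.Aut) : D.Reeb ≃ₜ D.Reeb) (D.proj q) = D.proj (β.shear q)) ∧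
      ∀ f : D.AutRel, ∃ F : ReebCover ≃ₜ ReebCover,
        (∀ q, LeafwiseHolSmoothAt F q ∧ LeafwiseHolSmoothAt F.symm q) ∧
        (∀ q, D.proj (F q) = ((f : D.Aut) : D.Reeb ≃ₜ D.Reeb) (D.proj q)) ∧
        (∀ q : ReebCover, q.1.2 = 0 → F q = q) ∧
        ∀ q : ReebCover, (F q).1.2 = (E.rightHom f : DiffHalfLine).1 q.1.2) ∧
    -- the extension `0 → 𝒵_{φ,μ^p} × ⋯ × 𝒵_{φ,μ} → 𝒮_{φ,μ}(c) → 𝒵_{φ,μ} → 0`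
    (∃ E : GroupExtension
        (Multiplicative ((j : Fin D.p) → SpaceZ D.φ (D.mu ^ (D.p - (j : ℕ)))))
        D.S (Multiplicative (SpaceZ D.φ D.mu)),
      (∀ (b : (j : Fin D.p) → SpaceZ D.φ (D.mu ^ (D.p - (j : ℕ)))),
        (∀ j, (E.inl (Multiplicative.ofAdd b)).beta1 j = b j) ∧
        (E.inl (Multiplicative.ofAdd b)).beta2 = 0) ∧
      ∀ β : D.S, ((E.rightHom β).toAdd : ℝ≥0 → ℂ) = β.beta2) ∧
    -- the vector spaces `𝒵_{φ,μ^k}` occurring here have infinite dimension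
    ∀ k : ℕ, 1 ≤ k → k ≤ D.p → ¬ FiniteDimensional ℂ (SpaceZ D.φ (D.mu ^ k)) := by
  refine ⟨⟨HopfData.autExtension hφ hτ hlam, fun β q => rfl, fun f => ?_⟩,
    ⟨D.solutionExtension, fun b => ⟨fun j => rfl, rfl⟩, fun β => rfl⟩,
    fun k _ _ => not_finiteDimensional_spaceZ D.expanding (pow_ne_zero _ D.mu_ne_zero)⟩
  -- The required lift of `f` is its preimage under `descendEquiv`.
  obtain ⟨P, rfl⟩ := D.descendEquiv.surjective f
  refine ⟨⟨P.1, continuous_of_leafwiseHolSmoothAt P.2.1.1,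
    continuous_of_leafwiseHolSmoothAt P.2.1.2⟩, fun q => ⟨P.2.1.1 q, P.2.1.2 q⟩, fun q => rfl,
    P.2.2.2, fun q => ?_⟩
  have h1 : (HopfData.autExtension hφ hτ hlam).rightHom (D.descendEquiv P) = D.level P :=
    congrArg D.level (D.descendEquiv.symm_apply_apply P)
  rw [h1]
  exact D.level_apply P q
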